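/- **Setting.** A d-space is a topological space $X$ with a set of paths $[0,1]\to X$ (d-paths) that contains the constant paths and is closed under concatenation and non-decreasing reparametrization; a d-map is a continuous map preserving d-paths. $\vec T(X)_x^y$ denotes the space of d-paths from $x$ to $y$ (compact-open topology) modulo reparametrization by surjective non-decreasing maps of $[0,1]$. The fundamental category $\vec\pi_1(X)$ has the points of $X$ as objects, $\pi_0(\vec T(X)_x^y)$ as morphisms $x\to y$, and composition by concatenation. $E\vec\pi_1(X)$ has as objects the pairs $(x,y)$ with $\vec T(X)_x^y\neq\emptyset$, and as morphisms $(x,y)\to(x',y')$ the pairs $(\sigma *,*\tau)$ with $\sigma\in\vec\pi_1(X)(x',x)$, $\tau\in\vec\pi_1(X)(y,y')$. Let $\mathcal F$ be a family of continuous maps that contains all homotopy equivalences and consists of maps bijective on $\pi_0$ (e.g. weak homotopy equivalences, $\pi_0$-bijections, or isomorphisms on $H_i(-;A)$, $i\le k$, with $A\ne 0$), with an associated notion of a self-map being $\mathcal F$-homotopic to the identity, implied by being homotopic to the identity and implying that the self-map induces the identity on $\pi_0$. An endo-d-map $f$ of $X$ is $\mathcal F$-psp if $\vec T(f):\vec T(X)_x^y\to\vec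 T(X)_{fx}^{fy}$ is in $\mathcal F$ for all objects $(x,y)$. A simple d-homotopy is a d-map $H:X\times\vec I\to X$, where the d-paths of $\vec I=[0,1]$ are the non-decreasing ones. The map $f$ is inessential of flavour $\alpha=+$ (resp. $-$) if there is a simple d-homotopy with all $H_t$ $\mathcal F$-psp from $\mathrm{id}_X$ to $f$ (resp. from $f$ to $\mathrm{id}_X$), and of flavour $\alpha=0$ if there is a d-map $H:X\times I\to X$ with all $H_t$ $\mathcal F$-psp, $H_0=\mathrm{id}_X$, $H_1=f$, where $I=[0,1]$ has only constant d-paths. An $\alpha$-inessential map $f$ with $f(x)=x'$, $f(y)=y'$ is regarded as a morphism $(x,y)\to(x',y')$; for $\alpha=\pm$ these are the $+$-inessential $f$ for which some $-$-inessential $g$ satisfies $g(x')=x$, $g(y')=y$ and $\vec T(g\circ f)$ on $\vec T(X)_x^y$ is $\mathcal F$-homotopic to the identity. Let $\Sigma^\alpha_{\mathcal F}E\vec\pi_1(X)$ be the category with the objects of $E\vec\pi_1(X)$, generated by $E\vec\pi_1(X)$ and the $\alpha$-inessential morphisms (composed as maps), modulo $(f\sigma *,*f\tau)\circ f=f\circ(\sigma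 *,*\tau)$ and $*H(y)\circ f=H(x)*\circ g$ on $(x,y)$ for simple d-homotopies $H$ from $f$ to $g$, where $f$ and $g$ are $\alpha$-inessential at $(x,y)$ and one of them is $\mathrm{id}_X$. The pair component category $\vec\pi_0(X;\alpha,\mathcal F)_*^*$ is its quotient category in which all inessential morphisms become identities; its objects are the components of pairs under zig-zags of inessential morphisms. The directed circle $\vec S^1$ is the unit circle whose d-paths are $t\mapsto e^{ig(t)}$ with $g:[0,1]\to\mathbb R$ continuous and non-decreasing; $\vec T^n=(\vec S^1)^n$, a path being directed iff all its coordinates are. **Proposition.** Let $n\in\mathbb N$, $\alpha\in\{+,-,0,\pm\}$ and $\mathcal F$ as above. 1. There is an isomorphism of categories $\vec\pi_0(\vec T^n;\alpha,\mathcal F)_*^*\cong\prod_{i=1}^n\vec\pi_0(\vec S^1;\alpha,\mathcal F)_*^*$ induced by the coordinate projections, i.e. compatible with the functors $E\vec\pi_1(\vec T^n)\to E\vec\pi_1(\vec S^1)$ induced by the projections. 2. $\vec\pi_0(\vec T^n;\alpha,\mathcal F)_*^*$ has $2^n$ objects. It is isomorphic to the category with objects the bit vectors $\mathbf d\in\{0,1\}^n$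 (with $\Delta\leftrightarrow 0$, $\Gamma\leftrightarrow 1$), morphism sets $\mathrm{Mor}(\mathbf d,\mathbf d')=\prod_{i=1}^n M_i$, where $M_i=\mathbb N=\{1,2,\dots\}$ if $(d_i,d'_i)=(1,0)$ and $M_i=\mathbb N_{\ge 0}$ otherwise, and composition given by coordinatewise addition. Under this isomorphism the component of $(x,y)$ corresponds to the vector with $d_i=0$ if $x_i=y_i$ and $d_i=1$ if $x_i\neq y_i$. 3. Every inessential d-map $F$ of $\vec T^n$ (of any flavour) is a product $F=f_1\times\cdots\times f_n$ of directed homeomorphisms $f_i:\vec S^1\to\vec S^1$ (homeomorphisms that are d-maps together with their inverses). -/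

import Mathlib

open CategoryTheory

universe u v w

/-! ## Directed spaces -/

/-- A d-structure on a topological space `X`: a set of paths `[0,1] → X` (the d-paths) that contains the
constant paths and is closed under concatenation and under non-decreasing (not necessarily
surjective) reparametrization. -/
structure DStructure (X : Type u) [TopologicalSpace X] where
  dpaths : Set C(unitInterval, X)
  const_mem : ∀ x : X, ContinuousMap.const unitInterval x ∈ dpaths
  trans_mem : ∀ {x y z : X} (p : Path x y) (q : Path y z),
    p.toContinuousMap ∈ dpaths → q.toContinuousMap ∈ dpaths → (p.trans q).toContinuousMap ∈ dpaths
  reparam_mem : ∀ γ ∈ dpaths, ∀ φ : C(unitInterval, unitInterval), Monotone φ → γ.comp φ ∈ dpaths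

/-- A d-map is a continuous map that sends d-paths to d-paths. -/
def IsDMap {X : Type u} {Y : Type v} [TopologicalSpace X] [TopologicalSpace Y]
    (D : DStructure X) (E : DStructure Y) (f : C(X, Y)) : Prop :=
  ∀ γ ∈ D.dpaths, f.comp γ ∈ E.dpaths

lemma IsDMap.comp {X : Type u} {Y : Type v} {Z : Type w} [TopologicalSpace X] [TopologicalSpace Y]
    [TopologicalSpace Z] {D : DStructure X} {E : DStructure Y} {F : DStructure Z}
    {g : C(Y, Z)} {f : C(X, Y)} (hg : IsDMap E F g) (hf : IsDMap D E f) : IsDMap D F (g.comp f) :=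
  fun γ hγ => hg _ (hf γ hγ)

lemma monotone_path_trans {X : Type u} [TopologicalSpace X] [Preorder X] {x y z : X}
    (p : Path x y) (q : Path y z) (hp : Monotone p) (hq : Monotone q) : Monotone (p.trans q) := by
  intro s t hst
  have hst' : (s : ℝ) ≤ t := hst
  rw [Path.trans_apply, Path.trans_apply]
  split_ifs with h1 h2 h2
  · exact hp (Subtype.mk_le_mk.2 (by linarith))
  · refine le_trans (hp (unitInterval.le_one' (t := _))) ?_
    exact le_trans (le_of_eq (p.target.trans q.source.symm)) (hq unitInterval.nonneg')
  · exact absurd (hst'.trans h2) h1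
  · exact hq (Subtype.mk_le_mk.2 (by linarith))

/-- The d-structure of non-decreasing paths; on `[0,1]` it gives the directed interval. -/
def monotoneDStructure (X : Type u) [TopologicalSpace X] [Preorder X] : DStructure X where
  dpaths := {γ | Monotone γ}
  const_mem x := fun _ _ _ => le_refl x
  trans_mem p q hp hq := monotone_path_trans p q hp hq
  reparam_mem γ hγ φ hφ := Monotone.comp (g := γ) (f := φ) hγ hφ

/-- The discrete d-structure, with only the constant paths; on `[0,1]` it gives the undirected
interval. -/
def constDStructure (X : Type u) [TopologicalSpace X] : DStructure X where
  dpaths := {γ | ∀ s t, γ s = γ t}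
  const_mem x := fun _ _ => rfl
  trans_mem {x y z} p q hp hq := by
    have hxy : x = y := by simpa using hp 0 1
    have h1 : ∀ t, p t = y := fun t => by simpa using hp t 1
    have h2 : ∀ t, q t = y := fun t => by simpa using hq t 0
    have h : ∀ t, (p.trans q) t = y := fun t => by
      rw [Path.trans_apply]; split_ifs
      · exact h1 _
      · exact h2 _
    intro s t
    exact (h s).trans (h t).symm
  reparam_mem γ hγ φ _ := fun s t => hγ (φ s) (φ t)

/-- The product d-structure: a path is a d-path iff both components are. -/
def DStructure.prod {X : Type u} {Y : Type v} [TopologicalSpace X] [TopologicalSpace Y]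
    (D : DStructure X) (E : DStructure Y) : DStructure (X × Y) where
  dpaths := {γ | ContinuousMap.fst.comp γ ∈ D.dpaths ∧ ContinuousMap.snd.comp γ ∈ E.dpaths}
  const_mem x := ⟨D.const_mem x.1, E.const_mem x.2⟩
  trans_mem p q hp hq := by
    constructor
    · have := D.trans_mem (p.map continuous_fst) (q.map continuous_fst) hp.1 hq.1
      rw [← Path.map_trans] at this
      exact this
    · have := E.trans_mem (p.map continuous_snd) (q.map continuous_snd) hp.2 hq.2
      rw [← Path.map_trans] at this
      exact this
  reparam_mem γ hγ φ hφ := ⟨D.reparam_mem _ hγ.1 φ hφ, E.reparam_mem _ hγ.2 φ hφ⟩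

/-- The product d-structure on a product of a family. -/
def DStructure.pi {ι : Type v} {X : ι → Type u} [∀ i, TopologicalSpace (X i)]
    (D : ∀ i, DStructure (X i)) : DStructure (∀ i, X i) where
  dpaths := {γ | ∀ i, (ContinuousMap.eval i).comp γ ∈ (D i).dpaths}
  const_mem x := fun i => (D i).const_mem (x i)
  trans_mem p q hp hq := fun i => by
    have := (D i).trans_mem (p.map (continuous_apply i)) (q.map (continuous_apply i)) (hp i) (hq i)
    rw [← Path.map_trans] at this
    exact this
  reparam_mem γ hγ φ hφ := fun i => (D i).reparam_mem _ (hγ i) φ hφ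

/-! ## Trace spaces -/

section Traces

variable {X : Type u} [TopologicalSpace X] (D : DStructure X)

/-- The space of d-paths from `x` to `y`, with the compact-open topology. -/
def DPath (x y : X) : Type u := {p : Path x y // p.toContinuousMap ∈ D.dpaths}

instance (x y : X) : TopologicalSpace (DPath D x y) :=
  inferInstanceAs (TopologicalSpace {p : Path x y // p.toContinuousMap ∈ D.dpaths})

variable {D}

/-- The constant d-path. -/
def DPath.refl (x : X) : DPath D x x := ⟨Path.refl x, D.const_mem x⟩

/-- Concatenation of d-paths. -/
noncomputable def DPath.trans {x y z : X} (p : DPath D x y) (q : DPath D y z) : DPath D x z :=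
  ⟨p.1.trans q.1, D.trans_mem p.1 q.1 p.2 q.2⟩

/-- The image of a d-path under a d-map. -/
def DPath.map {Y : Type v} [TopologicalSpace Y] {E : DStructure Y} (f : C(X, Y)) (hf : IsDMap D E f)
    {x y : X} {x' y' : Y} (hx : f x = x') (hy : f y = y') (p : DPath D x y) : DPath E x' y' :=
  ⟨{ toContinuousMap := f.comp p.1.toContinuousMap
     source' := by simp [hx]
     target' := by simp [hy] }, hf _ p.2⟩

/-- `q` is a reparametrization `p ∘ φ` of `p` by a surjective non-decreasing map `φ : unitInterval → I`. -/
def DPath.IsReparam {x y : X} (p q : DPath D x y) : Prop :=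
  ∃ φ : C(unitInterval, unitInterval), Monotone φ ∧ Function.Surjective φ ∧ ∀ t, q.1 t = p.1 (φ t)

variable (D)

/-- The space of traces from `x` to `y`: the quotient of the space of d-paths by the equivalence
relation generated by reparametrization, with the quotient topology. -/
def Trace (x y : X) : Type u := Quot (DPath.IsReparam (D := D) (x := x) (y := y))

instance (x y : X) : TopologicalSpace (Trace D x y) :=
  inferInstanceAs (TopologicalSpace (Quot (DPath.IsReparam (D := D) (x := x) (y := y))))

variable {D}

/-- The trace of a d-path. -/
def Trace.mk {x y : X} (p : DPath D x y) : Trace D x y := Quot.mk _ p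

lemma DPath.continuous_map {Y : Type v} [TopologicalSpace Y] {E : DStructure Y} (f : C(X, Y))
    (hf : IsDMap D E f) {x y : X} {x' y' : Y} (hx : f x = x') (hy : f y = y') :
    Continuous (DPath.map (x := x) (y := y) f hf hx hy) := by
  refine Continuous.subtype_mk ?_ _
  refine continuous_induced_rng.2 ?_
  exact f.continuous_postcomp.comp (continuous_induced_dom.comp continuous_subtype_val)

/-- The continuous map of trace spaces `[σ] ↦ [f ∘ σ]` induced by a d-map. -/
def traceMap {Y : Type v} [TopologicalSpace Y] {E : DStructure Y} (f : C(X, Y))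
    (hf : IsDMap D E f) {x y : X} {x' y' : Y} (hx : f x = x') (hy : f y = y') :
    C(Trace D x y, Trace E x' y') where
  toFun := Quot.lift (fun p => Trace.mk (DPath.map f hf hx hy p)) (by
    rintro p q ⟨φ, hφ, hs, h⟩
    refine Quot.sound ⟨φ, hφ, hs, fun t => ?_⟩
    exact congrArg f (h t))
  continuous_toFun :=
    continuous_quot_lift _ (continuous_quot_mk.comp (DPath.continuous_map f hf hx hy))

lemma reparam_surjective (φ : C(unitInterval, unitInterval)) (h0 : φ 0 = 0) (h1 : φ 1 = 1) : Function.Surjective φ := by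
  intro y
  exact mem_range_of_exists_le_of_exists_ge φ.continuous ⟨0, by rw [h0]; exact unitInterval.nonneg'⟩
    ⟨1, by rw [h1]; exact unitInterval.le_one'⟩

lemma reparam_ends {φ : C(unitInterval, unitInterval)} (hm : Monotone φ) (hs : Function.Surjective φ) :
    φ 0 = 0 ∧ φ 1 = 1 := by
  obtain ⟨a, ha⟩ := hs 0
  obtain ⟨b, hb⟩ := hs 1
  exact ⟨le_antisymm ((hm unitInterval.nonneg').trans ha.le) unitInterval.nonneg',
    le_antisymm unitInterval.le_one' (hb.symm.le.trans (hm unitInterval.le_one'))⟩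

lemma DPath.IsReparam.trans {x y z : X} {p p' : DPath D x y} {q q' : DPath D y z}
    (hp : p.IsReparam p') (hq : q.IsReparam q') : (p.trans q).IsReparam (p'.trans q') := by
  obtain ⟨φ, hφ, hφs, h⟩ := hp
  obtain ⟨χ, hχ, hχs, k⟩ := hq
  obtain ⟨φ0, φ1⟩ := reparam_ends hφ hφs
  obtain ⟨χ0, χ1⟩ := reparam_ends hχ hχs
  let m : unitInterval := ⟨1 / 2, by norm_num, by norm_num⟩
  let a : Path (0 : unitInterval) m :=
    { toFun := fun t => ⟨(φ t : ℝ) / 2, by have := (φ t).2.1; positivity,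
        by have := (φ t).2.2; linarith⟩
      continuous_toFun := by fun_prop
      source' := by simp [φ0]
      target' := by simp [φ1, m] }
  let b : Path m (1 : unitInterval) :=
    { toFun := fun t => ⟨(1 + (χ t : ℝ)) / 2, by have := (χ t).2.1; positivity,
        by have := (χ t).2.2; linarith⟩
      continuous_toFun := by fun_prop
      source' := by simp [χ0, m]
      target' := by ext; simp [χ1] }
  have ha : Monotone a := fun s t hst => Subtype.mk_le_mk.2 (by
    have : (φ s : ℝ) ≤ φ t := hφ hst
    linarith)
  have hb : Monotone b := fun s t hst => Subtype.mk_le_mk.2 (by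
    have : (χ s : ℝ) ≤ χ t := hχ hst
    linarith)
  refine ⟨(a.trans b).toContinuousMap, monotone_path_trans a b ha hb,
    reparam_surjective _ (a.trans b).source (a.trans b).target, fun t => ?_⟩
  change (p'.1.trans q'.1) t = (p.1.trans q.1) ((a.trans b) t)
  rw [Path.trans_apply, Path.trans_apply a b]
  split_ifs with ht
  · rw [h, Path.trans_apply, dif_pos]
    · congr 1
      ext
      change _ = 2 * ((φ _ : ℝ) / 2)
      ring
    · change (φ _ : ℝ) / 2 ≤ 1 / 2
      have := (φ ⟨2 * t, (unitInterval.mul_pos_mem_iff zero_lt_two).2 ⟨t.2.1, ht⟩⟩).2.2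
      linarith
  · rw [k]
    set s : unitInterval := ⟨2 * (t : ℝ) - 1, unitInterval.two_mul_sub_one_mem_iff.2 ⟨(not_le.1 ht).le, t.2.2⟩⟩ with hs
    rw [Path.trans_apply]
    have hbs : ((b s : unitInterval) : ℝ) = (1 + (χ s : ℝ)) / 2 := rfl
    split_ifs with hc
    · have hz : (χ s : ℝ) = 0 := by
        have := (χ s).2.1
        rw [hbs] at hc
        linarith
      have hz' : χ s = 0 := Subtype.ext hz
      have e : (⟨2 * ((b s : unitInterval) : ℝ), (unitInterval.mul_pos_mem_iff zero_lt_two).2 ⟨(b s).2.1, hc⟩⟩ : unitInterval) = 1 := by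
        ext
        change 2 * ((b s : unitInterval) : ℝ) = 1
        rw [hbs, hz]
        norm_num
      rw [e, hz', p.1.target, q.1.source]
    · congr 1
      ext
      change (χ s : ℝ) = 2 * ((b s : unitInterval) : ℝ) - 1
      rw [hbs]
      ring

lemma DPath.isReparam_refl {x y : X} (p : DPath D x y) : p.IsReparam p :=
  ⟨ContinuousMap.id unitInterval, fun _ _ h => h, fun t => ⟨t, rfl⟩, fun _ => rfl⟩

/-- The constant trace. -/
def Trace.refl (x : X) : Trace D x x := Trace.mk (DPath.refl x)

/-- Concatenation of traces. -/
noncomputable def Trace.trans {x y z : X} (σ : Trace D x y) (τ : Trace D y z) : Trace D x z :=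
  Quot.map₂ DPath.trans (fun p _ _ h => (p.isReparam_refl).trans h)
    (fun _ _ q h => h.trans q.isReparam_refl) σ τ

lemma Trace.refl_trans {x y : X} (σ : Trace D x y) : (Trace.refl x).trans σ = σ := by
  induction σ using Quot.ind with | mk p =>
  refine (Quot.sound ⟨⟨fun t => ⟨max 0 (2 * (t : ℝ) - 1), le_max_left _ _,
    max_le zero_le_one (by linarith [t.2.2])⟩, by fun_prop⟩, ?_, ?_, ?_⟩).symm
  · intro s t hst
    have : (s : ℝ) ≤ t := hst
    exact Subtype.mk_le_mk.2 (max_le_max le_rfl (by linarith))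
  · apply reparam_surjective
    · ext; simp
    · ext; simp; norm_num
  · intro t
    change ((Path.refl x).trans p.1) t = _
    rw [Path.trans_apply]
    split_ifs with h
    · have : (⟨max 0 (2 * (t : ℝ) - 1), le_max_left _ _,
          max_le zero_le_one (by linarith [t.2.2])⟩ : unitInterval) = 0 := by
        ext
        exact max_eq_left (by linarith)
      simp [this]
    · congr 1
      ext
      exact (max_eq_right (by linarith)).symm

lemma Trace.trans_refl {x y : X} (σ : Trace D x y) : σ.trans (Trace.refl y) = σ := by
  induction σ using Quot.ind with | mk p =>
  refine (Quot.sound ⟨⟨fun t => ⟨_, Path.Homotopy.transReflReparamAux_mem_I t⟩, by fun_prop⟩,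
    ?_, ?_, ?_⟩).symm
  · intro s t hst
    have : (s : ℝ) ≤ t := hst
    refine Subtype.mk_le_mk.2 ?_
    unfold Path.Homotopy.transReflReparamAux
    split_ifs <;> linarith
  · apply reparam_surjective
    · exact Subtype.ext Path.Homotopy.transReflReparamAux_zero
    · exact Subtype.ext Path.Homotopy.transReflReparamAux_one
  · intro t
    exact congrArg (fun r : Path x y => r t) (Path.Homotopy.trans_refl_reparam p.1)

lemma Trace.trans_assoc {x y z w : X} (ρ : Trace D x y) (σ : Trace D y z) (τ : Trace D z w) :
    (ρ.trans σ).trans τ = ρ.trans (σ.trans τ) := by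
  induction ρ using Quot.ind with | mk p =>
  induction σ using Quot.ind with | mk q =>
  induction τ using Quot.ind with | mk r =>
  refine (Quot.sound ⟨⟨fun t => ⟨_, Path.Homotopy.transAssocReparamAux_mem_I t⟩, by fun_prop⟩,
    ?_, ?_, ?_⟩).symm
  · intro s t hst
    have : (s : ℝ) ≤ t := hst
    refine Subtype.mk_le_mk.2 ?_
    unfold Path.Homotopy.transAssocReparamAux
    split_ifs <;> linarith
  · apply reparam_surjective
    · exact Subtype.ext Path.Homotopy.transAssocReparamAux_zero
    · exact Subtype.ext Path.Homotopy.transAssocReparamAux_one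
  · intro t
    exact congrArg (fun r : Path x w => r t) (Path.Homotopy.trans_assoc_reparam p.1 q.1 r.1)

lemma Trace.continuous_trans_left {x y z : X} (τ : Trace D y z) :
    Continuous (fun σ : Trace D x y => σ.trans τ) := by
  induction τ using Quot.ind with | mk q =>
  refine continuous_coinduced_dom.2 (continuous_quot_mk.comp (Continuous.subtype_mk ?_ _))
  exact Path.continuous_trans.comp (continuous_subtype_val.prodMk continuous_const)

lemma Trace.continuous_trans_right {x y z : X} (σ : Trace D x y) :
    Continuous (fun τ : Trace D y z => σ.trans τ) := by
  induction σ using Quot.ind with | mk p =>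
  refine continuous_coinduced_dom.2 (continuous_quot_mk.comp (Continuous.subtype_mk ?_ _))
  exact Path.continuous_trans.comp (continuous_const.prodMk continuous_subtype_val)

/-! ## The fundamental category -/

variable (D)

/-- The set of morphisms from `x` to `y` in the fundamental category: the path components of the
space of traces from `x` to `y`. -/
def FundHom (x y : X) : Type u := ZerothHomotopy (Trace D x y)

variable {D}

/-- The class of a d-path. -/
def FundHom.mk {x y : X} (p : DPath D x y) : FundHom D x y := ZerothHomotopy.mk (Trace.mk p)

/-- The map on path components induced by a continuous map. -/
def zerothMap {A : Type u} {B : Type v} [TopologicalSpace A] [TopologicalSpace B] (f : C(A, B)) :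
    ZerothHomotopy A → ZerothHomotopy B :=
  ZerothHomotopy.lift (fun a => ZerothHomotopy.mk (f a))
    (fun _ _ γ => ZerothHomotopy.sound (γ.map f.continuous))

/-- The identity at `x`. -/
def FundHom.refl (x : X) : FundHom D x x := FundHom.mk (DPath.refl x)

/-- Composition in the fundamental category, induced by concatenation. -/
noncomputable def FundHom.trans {x y z : X} (σ : FundHom D x y) (τ : FundHom D y z) : FundHom D x z :=
  ZerothHomotopy.lift
    (fun a => ZerothHomotopy.lift (fun b => ZerothHomotopy.mk (a.trans b))
      (fun _ _ γ => ZerothHomotopy.sound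
        (γ.map (f := fun b => a.trans b) (Trace.continuous_trans_right a))) τ)
    (fun a a' γ => by
      obtain ⟨b, rfl⟩ := ZerothHomotopy.mk_surjective τ
      exact ZerothHomotopy.sound
        (γ.map (f := fun a => a.trans b) (Trace.continuous_trans_left b))) σ

/-- The map induced by a d-map on morphisms of the fundamental category. -/
def FundHom.map {Y : Type v} [TopologicalSpace Y] {E : DStructure Y} (f : C(X, Y))
    (hf : IsDMap D E f) {x y : X} {x' y' : Y} (hx : f x = x') (hy : f y = y') :
    FundHom D x y → FundHom E x' y' :=
  zerothMap (traceMap f hf hx hy)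

lemma FundHom.refl_trans {x y : X} (σ : FundHom D x y) : (FundHom.refl x).trans σ = σ := by
  obtain ⟨a, rfl⟩ := ZerothHomotopy.mk_surjective σ
  exact congrArg ZerothHomotopy.mk a.refl_trans

lemma FundHom.trans_refl {x y : X} (σ : FundHom D x y) : σ.trans (FundHom.refl y) = σ := by
  obtain ⟨a, rfl⟩ := ZerothHomotopy.mk_surjective σ
  exact congrArg ZerothHomotopy.mk a.trans_refl

lemma FundHom.trans_assoc {x y z w : X} (ρ : FundHom D x y) (σ : FundHom D y z)
    (τ : FundHom D z w) : (ρ.trans σ).trans τ = ρ.trans (σ.trans τ) := by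
  obtain ⟨a, rfl⟩ := ZerothHomotopy.mk_surjective ρ
  obtain ⟨b, rfl⟩ := ZerothHomotopy.mk_surjective σ
  obtain ⟨c, rfl⟩ := ZerothHomotopy.mk_surjective τ
  exact congrArg ZerothHomotopy.mk (a.trans_assoc b c)

lemma FundHom.map_refl {Y : Type v} [TopologicalSpace Y] {E : DStructure Y} (f : C(X, Y))
    (hf : IsDMap D E f) {x : X} {x' : Y} (hx : f x = x') :
    FundHom.map f hf hx hx (FundHom.refl x) = FundHom.refl x' := by
  subst hx
  rfl

lemma FundHom.map_trans {Y : Type v} [TopologicalSpace Y] {E : DStructure Y} (f : C(X, Y))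
    (hf : IsDMap D E f) {x y z : X} {x' y' z' : Y} (hx : f x = x') (hy : f y = y') (hz : f z = z')
    (σ : FundHom D x y) (τ : FundHom D y z) :
    FundHom.map f hf hx hz (σ.trans τ) =
      (FundHom.map f hf hx hy σ).trans (FundHom.map f hf hy hz τ) := by
  subst hx hy hz
  obtain ⟨a, rfl⟩ := ZerothHomotopy.mk_surjective σ
  obtain ⟨b, rfl⟩ := ZerothHomotopy.mk_surjective τ
  induction a using Quot.ind with | mk p =>
  induction b using Quot.ind with | mk q =>
  refine congrArg (FundHom.mk (D := E)) (Subtype.ext ?_)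
  exact Path.map_trans p.1 q.1 f.continuous

end Traces

/-! ## The extension category of the fundamental category -/

/-- The reachable pairs of a d-space. -/
@[ext]
structure RPair {X : Type u} [TopologicalSpace X] (D : DStructure X) where
  src : X
  tgt : X
  reachable : Nonempty (DPath D src tgt)

section Ext

variable {X : Type u} [TopologicalSpace X] {D : DStructure X}

/-- The extension category: a morphism `(x, y) ⟶ (x', y')` is a pair of a class of d-paths from `x'`
to `x` and a class of d-paths from `y` to `y'`. -/
noncomputable instance extensionCategory : Category (RPair D) where
  Hom p q := FundHom D q.src p.src × FundHom D p.tgt q.tgt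
  id p := (FundHom.refl p.src, FundHom.refl p.tgt)
  comp e e' := (e'.1.trans e.1, e.2.trans e'.2)
  id_comp _ := Prod.ext (FundHom.trans_refl _) (FundHom.refl_trans _)
  comp_id _ := Prod.ext (FundHom.refl_trans _) (FundHom.trans_refl _)
  assoc _ _ _ := Prod.ext (FundHom.trans_assoc _ _ _).symm (FundHom.trans_assoc _ _ _)

/-- The image of a reachable pair under a d-map. -/
def RPair.map {Y : Type v} [TopologicalSpace Y] {E : DStructure Y} (f : C(X, Y))
    (hf : IsDMap D E f) (p : RPair D) : RPair E :=
  ⟨f p.src, f p.tgt, p.reachable.map (DPath.map f hf rfl rfl)⟩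

/-- The functor between extension categories induced by a d-map. -/
noncomputable def extMap {Y : Type v} [TopologicalSpace Y] {E : DStructure Y} (f : C(X, Y))
    (hf : IsDMap D E f) : RPair D ⥤ RPair E where
  obj p := p.map f hf
  map e := (FundHom.map f hf rfl rfl e.1, FundHom.map f hf rfl rfl e.2)
  map_id _ := Prod.ext (FundHom.map_refl f hf rfl) (FundHom.map_refl f hf rfl)
  map_comp _ _ := Prod.ext (FundHom.map_trans f hf rfl rfl rfl _ _)
    (FundHom.map_trans f hf rfl rfl rfl _ _)

end Ext

/-! ## Families of equivalences, homotopy flows, inessential d-maps -/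

/-- A family `𝓕` of continuous maps used to compare trace spaces, sandwiched between the homotopy
equivalences and the maps that are bijective on path components, with the notion of being
`𝓕`-homotopic to the identity, sandwiched between being homotopic to the identity and inducing the
identity on path components.
Instances: (weak) homotopy equivalences, with self-maps inducing the identity on homotopy groups;
`π₀`-bijections, with self-maps inducing the identity on `π₀`; maps inducing isomorphisms on
homology with non-zero coefficients up to degree `k`, with self-maps inducing the identity there. -/
structure EquivalenceFamily where
  IsEquiv : ∀ {A B : Type u} [TopologicalSpace A] [TopologicalSpace B], C(A, B) → Prop
  IsHomotopicToId : ∀ {A : Type u} [TopologicalSpace A], C(A, A) → Prop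
  isEquiv_of_homotopyEquiv : ∀ {A B : Type u} [TopologicalSpace A] [TopologicalSpace B]
    (f : C(A, B)) (g : C(B, A)), (g.comp f).Homotopic (ContinuousMap.id A) →
    (f.comp g).Homotopic (ContinuousMap.id B) → IsEquiv f
  bijective_of_isEquiv : ∀ {A B : Type u} [TopologicalSpace A] [TopologicalSpace B]
    (f : C(A, B)), IsEquiv f → Function.Bijective (zerothMap f)
  isHomotopicToId_of_homotopic : ∀ {A : Type u} [TopologicalSpace A] (f : C(A, A)),
    f.Homotopic (ContinuousMap.id A) → IsHomotopicToId f
  zerothMap_of_isHomotopicToId : ∀ {A : Type u} [TopologicalSpace A] (f : C(A, A)),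
    IsHomotopicToId f → zerothMap f = id

section Flows

variable {X : Type u} [TopologicalSpace X] (𝓕 : EquivalenceFamily.{u}) (D : DStructure X)

/-- `f` is an endo-d-map that is `𝓕`-path space preserving. -/
def IsPsp (f : C(X, X)) : Prop :=
  ∃ hf : IsDMap D D f, ∀ p : RPair D,
    𝓕.IsEquiv (traceMap f hf (rfl : f p.src = f p.src) (rfl : f p.tgt = f p.tgt))

/-- The level map `H_t` of a homotopy. -/
def level (H : C(X × unitInterval, X)) (t : unitInterval) : C(X, X) :=
  H.comp ((ContinuousMap.id X).prodMk (ContinuousMap.const X t))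

/-- A simple (future) d-homotopy: a d-map on the product of `X` with the directed interval. -/
def IsSimpleDHomotopy (H : C(X × unitInterval, X)) : Prop := IsDMap (D.prod (monotoneDStructure unitInterval)) D H

/-- A dihomotopy: a d-map on the product of `X` with the undirected interval. -/
def IsDihomotopy (H : C(X × unitInterval, X)) : Prop := IsDMap (D.prod (constDStructure unitInterval)) D H

/-- There is a future psp homotopy flow from the identity to `f`. -/
def IsFutureInessential (f : C(X, X)) : Prop :=
  ∃ H : C(X × unitInterval, X), IsSimpleDHomotopy D H ∧ (∀ t, IsPsp 𝓕 D (level H t)) ∧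
    level H 0 = ContinuousMap.id X ∧ level H 1 = f

/-- There is a past psp homotopy flow from `f` to the identity. -/
def IsPastInessential (f : C(X, X)) : Prop :=
  ∃ H : C(X × unitInterval, X), IsSimpleDHomotopy D H ∧ (∀ t, IsPsp 𝓕 D (level H t)) ∧
    level H 0 = f ∧ level H 1 = ContinuousMap.id X

/-- There is a neutral psp homotopy flow from the identity to `f`. -/
def IsNeutralInessential (f : C(X, X)) : Prop :=
  ∃ H : C(X × unitInterval, X), IsDihomotopy D H ∧ (∀ t, IsPsp 𝓕 D (level H t)) ∧
    level H 0 = ContinuousMap.id X ∧ level H 1 = f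

/-- The flavours `+`, `-`, `0`, `±`. -/
inductive Flavour
  | future
  | past
  | neutral
  | total

/-- `f` is a morphism from `p` to `q` in the subcategory of inessential maps of flavour `α`. -/
def IsInessential (α : Flavour) (f : C(X, X)) (p q : RPair D) : Prop :=
  f p.src = q.src ∧ f p.tgt = q.tgt ∧
    match α with
    | .future => IsFutureInessential 𝓕 D f
    | .past => IsPastInessential 𝓕 D f
    | .neutral => IsNeutralInessential 𝓕 D f
    | .total => IsFutureInessential 𝓕 D f ∧
        ∃ g : C(X, X), IsPastInessential 𝓕 D g ∧
          ∃ (hgf : IsDMap D D (g.comp f)) (hs : g.comp f p.src = p.src)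
            (ht : g.comp f p.tgt = p.tgt), 𝓕.IsHomotopicToId (traceMap (g.comp f) hgf hs ht)

variable {D}

/-- The d-path `t ↦ H (x, t)` of a simple d-homotopy `H`. -/
def flowPath (H : C(X × unitInterval, X)) (hH : IsSimpleDHomotopy D H) {x a b : X} (ha : H (x, 0) = a)
    (hb : H (x, 1) = b) : DPath D a b :=
  ⟨{ toContinuousMap := H.comp ((ContinuousMap.const unitInterval x).prodMk (ContinuousMap.id unitInterval))
     source' := ha
     target' := hb },
    hH _ ⟨D.const_mem x, fun _ _ h => h⟩⟩

end Flows

/-! ## The category of inessential maps and extensions -/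

section Mixed

variable {X : Type u} [TopologicalSpace X] (𝓕 : EquivalenceFamily.{u}) (α : Flavour)
  (D : DStructure X)

/-- Reachable pairs, as vertices of the quiver of generators. -/
structure MixedVertex (_𝓕 : EquivalenceFamily.{u}) (_α : Flavour) (D : DStructure X) where
  pair : RPair D

variable {D}

/-- The generating morphisms: extensions and inessential d-maps. -/
inductive MixedGen (p q : RPair D) : Type u
  | ext (e : p ⟶ q)
  | map (f : C(X, X)) (hf : IsInessential 𝓕 D α f p q)

variable (D)

instance mixedQuiver : Quiver (MixedVertex 𝓕 α D) where
  Hom p q := MixedGen 𝓕 α p.pair q.pair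

variable {D}

/-- A reachable pair as an object of the free category on the generators. -/
def freeObj (p : RPair D) : Paths (MixedVertex 𝓕 α D) :=
  (Paths.of (MixedVertex 𝓕 α D)).obj ⟨p⟩

/-- An extension as a morphism of the free category. -/
def freeExt {p q : RPair D} (e : p ⟶ q) : freeObj 𝓕 α p ⟶ freeObj 𝓕 α q :=
  (Paths.of (MixedVertex 𝓕 α D)).map (X := ⟨p⟩) (Y := ⟨q⟩) (MixedGen.ext e)

/-- An inessential map as a morphism of the free category. -/
def freeMap {p q : RPair D} (f : C(X, X)) (hf : IsInessential 𝓕 D α f p q) :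
    freeObj 𝓕 α p ⟶ freeObj 𝓕 α q :=
  (Paths.of (MixedVertex 𝓕 α D)).map (X := ⟨p⟩) (Y := ⟨q⟩) (MixedGen.map f hf)

variable (D)

/-- The defining relations. The first four say that extensions compose as in the extension category
and inessential maps compose as maps; `square` is the compatibility of inessential maps with
extensions; `flow` says `*H(y) ∘ f = H(x)* ∘ g` on the pair `(x, y)`, for a simple d-homotopy `H`
from `f` to `g` one of which is the identity. -/
inductive MixedRel : HomRel (Paths (MixedVertex 𝓕 α D))
  | ext_id (p : RPair D) : MixedRel (freeExt 𝓕 α (𝟙 p)) (𝟙 (freeObj 𝓕 α p))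
  | ext_comp {p q r : RPair D} (e : p ⟶ q) (e' : q ⟶ r) :
      MixedRel (freeExt 𝓕 α e ≫ freeExt 𝓕 α e') (freeExt 𝓕 α (e ≫ e'))
  | map_id {p : RPair D} (h : IsInessential 𝓕 D α (ContinuousMap.id X) p p) :
      MixedRel (freeMap 𝓕 α (ContinuousMap.id X) h) (𝟙 (freeObj 𝓕 α p))
  | map_comp {p q r : RPair D} (f g : C(X, X)) (hf : IsInessential 𝓕 D α f p q)
      (hg : IsInessential 𝓕 D α g q r) (hgf : IsInessential 𝓕 D α (g.comp f) p r) :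
      MixedRel (freeMap 𝓕 α f hf ≫ freeMap 𝓕 α g hg) (freeMap 𝓕 α (g.comp f) hgf)
  | square {p q : RPair D} (f : C(X, X)) (hd : IsDMap D D f)
      (hp : IsInessential 𝓕 D α f p (p.map f hd)) (hq : IsInessential 𝓕 D α f q (q.map f hd))
      (e : p ⟶ q) :
      MixedRel (freeMap 𝓕 α f hp ≫ freeExt 𝓕 α ((extMap f hd).map e))
        (freeExt 𝓕 α e ≫ freeMap 𝓕 α f hq)
  | flow {p : RPair D} (f g : C(X, X)) (H : C(X × unitInterval, X)) (hH : IsSimpleDHomotopy D H)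
      (h0 : ∀ x, H (x, 0) = f x) (h1 : ∀ x, H (x, 1) = g x)
      (hid : f = ContinuousMap.id X ∨ g = ContinuousMap.id X)
      (hfd : IsDMap D D f) (hgd : IsDMap D D g)
      (hf : IsInessential 𝓕 D α f p (p.map f hfd)) (hg : IsInessential 𝓕 D α g p (p.map g hgd))
      (hr : Nonempty (DPath D (f p.src) (g p.tgt))) :
      MixedRel
        (freeMap 𝓕 α f hf ≫ freeExt 𝓕 α (p := p.map f hfd) (q := ⟨f p.src, g p.tgt, hr⟩)
          (FundHom.refl (f p.src), FundHom.mk (flowPath H hH (h0 p.tgt) (h1 p.tgt))))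
        (freeMap 𝓕 α g hg ≫ freeExt 𝓕 α (p := p.map g hgd) (q := ⟨f p.src, g p.tgt, hr⟩)
          (FundHom.mk (flowPath H hH (h0 p.src) (h1 p.src)), FundHom.refl (g p.tgt)))

/-- The category whose objects are the reachable pairs and whose morphisms are the finite
compositions of inessential maps and extensions, modulo the relations above. -/
abbrev MixedCategory : Type u := CategoryTheory.Quotient (MixedRel 𝓕 α D)

/-- The functor from the extension category. -/
noncomputable def extToMixed : RPair D ⥤ MixedCategory 𝓕 α D where
  obj p := (CategoryTheory.Quotient.functor (MixedRel 𝓕 α D)).obj (freeObj 𝓕 α p)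
  map e := (CategoryTheory.Quotient.functor (MixedRel 𝓕 α D)).map (freeExt 𝓕 α e)
  map_id p := (CategoryTheory.Quotient.sound _ (MixedRel.ext_id p)).trans (CategoryTheory.Functor.map_id _ _)
  map_comp e e' := (CategoryTheory.Quotient.sound _ (MixedRel.ext_comp e e')).symm.trans (Functor.map_comp _ _ _)

/-- The class of morphisms given by the inessential maps. -/
inductive inessentialMorphisms : MorphismProperty (MixedCategory 𝓕 α D)
  | map {p q : RPair D} (f : C(X, X)) (hf : IsInessential 𝓕 D α f p q) :
      inessentialMorphisms ((CategoryTheory.Quotient.functor (MixedRel 𝓕 α D)).map (freeMap 𝓕 α f hf))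

end Mixed

/-! ## Quotient of a category by a class of morphisms -/

section ComponentCategory

variable {C : Type u} [Category.{v} C] (W : MorphismProperty C)

/-- The path components of objects with respect to zig-zags of `W`-morphisms. -/
structure ComponentVertex where
  comp : Quot (fun x y : C => ∃ f : x ⟶ y, W f)

/-- The component of an object. -/
def componentOf (x : C) : ComponentVertex W := ⟨Quot.mk _ x⟩

variable {W} in
lemma componentOf_eq {x y : C} (f : x ⟶ y) (hf : W f) : componentOf W x = componentOf W y :=
  congrArg ComponentVertex.mk (Quot.sound ⟨f, hf⟩)

/-- The generating morphisms from a component `a` to a component `b`: the morphisms of `C` from an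
object of `a` to an object of `b`. -/
structure ComponentGen (a b : ComponentVertex W) where
  src : C
  tgt : C
  hom : src ⟶ tgt
  src_mem : componentOf W src = a
  tgt_mem : componentOf W tgt = b

instance componentQuiver : Quiver (ComponentVertex W) where
  Hom a b := ComponentGen W a b

/-- A morphism of `C` as a morphism of the free category, between any components that contain its
source and its target. -/
def componentHom {a b : ComponentVertex W} {x y : C} (f : x ⟶ y) (hx : componentOf W x = a)
    (hy : componentOf W y = b) :
    (Paths.of (ComponentVertex W)).obj a ⟶ (Paths.of (ComponentVertex W)).obj b :=
  (Paths.of (ComponentVertex W)).map (ComponentGen.mk x y f hx hy)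

/-- The defining relations: compositions and identities are as in `C`, and the morphisms in `W` are
identities. -/
inductive ComponentRel : HomRel (Paths (ComponentVertex W))
  | id (x : C) : ComponentRel (componentHom W (𝟙 x) rfl rfl) (𝟙 _)
  | comp {x y z : C} (f : x ⟶ y) (g : y ⟶ z) :
      ComponentRel (componentHom W f rfl rfl ≫ componentHom W g rfl rfl)
        (componentHom W (f ≫ g) rfl rfl)
  | collapse {x y : C} (f : x ⟶ y) (hf : W f) :
      ComponentRel (componentHom W f rfl (componentOf_eq f hf).symm) (𝟙 _)

/-- The quotient category `C / W`: objects are the components, and the morphisms of `W` become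
identities. -/
abbrev ComponentCategory : Type u := CategoryTheory.Quotient (ComponentRel W)

/-- The quotient functor. -/
def toComponentCategory : C ⥤ ComponentCategory W where
  obj x := (CategoryTheory.Quotient.functor (ComponentRel W)).obj
    ((Paths.of (ComponentVertex W)).obj (componentOf W x))
  map f := (CategoryTheory.Quotient.functor (ComponentRel W)).map (componentHom W f rfl rfl)
  map_id x := (CategoryTheory.Quotient.sound _ (ComponentRel.id x)).trans (CategoryTheory.Functor.map_id _ _)
  map_comp f g := (CategoryTheory.Quotient.sound _ (ComponentRel.comp f g)).symm.trans (Functor.map_comp _ _ _)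

end ComponentCategory

/-! ## Pair component categories -/

section PairComponents

variable {X : Type u} [TopologicalSpace X] (𝓕 : EquivalenceFamily.{u}) (α : Flavour)
  (D : DStructure X)

/-- The pair component category of a d-space. -/
abbrev PairComponentCategory : Type u := ComponentCategory (inessentialMorphisms 𝓕 α D)

/-- The canonical functor from the extension category to the pair component category. -/
noncomputable def pairComponent : RPair D ⥤ PairComponentCategory 𝓕 α D :=
  extToMixed 𝓕 α D ⋙ toComponentCategory (inessentialMorphisms 𝓕 α D)

end PairComponents

/-! ## The directed circle and the directed torus -/

/-- The directed circle: d-paths are the images of the non-decreasing paths under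
`t ↦ exp (i t)`. -/
noncomputable def dCircle : DStructure Circle where
  dpaths := {γ | ∃ g : C(unitInterval, ℝ), Monotone g ∧ γ = Circle.exp.comp g}
  const_mem x := by
    refine ⟨ContinuousMap.const _ (Complex.arg x), fun _ _ _ => le_rfl, ?_⟩
    ext t
    simp [Circle.exp_arg]
  trans_mem {x y z} p q hp hq := by
    obtain ⟨g, hg, hpg⟩ := hp
    obtain ⟨h, hh, hqh⟩ := hq
    have hp' : ∀ t, p t = Circle.exp (g t) := fun t => congrArg (fun k => k t) hpg
    have hq' : ∀ t, q t = Circle.exp (h t) := fun t => congrArg (fun k => k t) hqh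
    obtain ⟨m, hm⟩ := Circle.exp_eq_exp.1
      (((hp' 1).symm.trans p.target).trans (q.source.symm.trans (hq' 0)))
    let a : Path (g 0) (g 1) := ⟨g, rfl, rfl⟩
    let b : Path (g 1) (h 1 + m * (2 * Real.pi)) :=
      { toFun := fun t => h t + m * (2 * Real.pi)
        continuous_toFun := by fun_prop
        source' := hm.symm
        target' := rfl }
    refine ⟨(a.trans b).toContinuousMap, monotone_path_trans a b hg
      (fun s t hst => add_le_add_left (hh hst) _), ?_⟩
    ext t
    congr 1
    change (p.trans q) t = Circle.exp ((a.trans b) t)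
    rw [Path.trans_apply, Path.trans_apply]
    split_ifs
    · exact hp' _
    · rw [hq']
      exact Circle.exp_eq_exp.2 ⟨-m, by simp [b]⟩
  reparam_mem := by
    rintro γ ⟨g, hg, rfl⟩ φ hφ
    exact ⟨g.comp φ, hg.comp hφ, rfl⟩

/-- The directed `n`-torus, the product of `n` directed circles. -/
noncomputable def dTorus (n : ℕ) : DStructure (Fin n → Circle) := DStructure.pi fun _ => dCircle

/-- The projection of the `n`-torus to its `i`-th circle. -/
noncomputable def torusProj (n : ℕ) (i : Fin n) : C(Fin n → Circle, Circle) := ContinuousMap.eval i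

lemma isDMap_torusProj (n : ℕ) (i : Fin n) : IsDMap (dTorus n) dCircle (torusProj n i) :=
  fun _ hγ => hγ i

/-! ## The model category -/

/-- The bit vectors of length `n`; the bit `false` (`0`) stands for `Δ`, `true` (`1`) for `Γ`. -/
structure BitVec01 (n : ℕ) where
  bit : Fin n → Bool

/-- A morphism `d ⟶ d'` is a vector of natural numbers whose `i`-th coordinate is positive whenever
`(dᵢ, dᵢ') = (1, 0)`; composition is coordinatewise addition. -/
instance bitCategory (n : ℕ) : Category (BitVec01 n) where
  Hom d d' := {k : Fin n → ℕ // ∀ i, d.bit i = true → d'.bit i = false → 0 < k i}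
  id d := ⟨0, fun i h h' => by simp [h] at h'⟩
  comp {d d' d''} k l := ⟨k.1 + l.1, fun i h h'' => by
    cases h' : d'.bit i with
    | false => exact Nat.add_pos_left (k.2 i h h') _
    | true => exact Nat.add_pos_right _ (l.2 i h' h'')⟩
  id_comp k := Subtype.ext (zero_add k.1)
  comp_id k := Subtype.ext (add_zero k.1)
  assoc k l m := Subtype.ext (add_assoc k.1 l.1 m.1)

/-- A functor is an isomorphism of categories. -/
def IsIsoOfCategories {A : Type u} {B : Type v} [Category A] [Category B] (F : A ⥤ B) : Prop :=
  ∃ G : B ⥤ A, F ⋙ G = 𝟭 A ∧ G ⋙ F = 𝟭 B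

/-!
The d-paths of a directed torus lift, coordinate by coordinate, to non-decreasing real functions,
and a class in the fundamental category is determined by its endpoints and the lengths of its lifts.
An extension `(x, y) → (x', y')` therefore has a winding degree in each coordinate: the number of
full turns by which it prolongs the positive arc from `x` to `y`, compared with the arc from `x'` to
`y'`. Since `𝓕`-equivalences are bijective on `π₀`, a psp map homotopic to the identity cannot
change these degrees; this forces it to move each coordinate by a shift depending on that
coordinate only, so it is a product of directed homeomorphisms. Inessential maps thus preserve the
degree and have degree zero, and the degree descends to the pair component category.

Conversely, shifts are inessential of every flavour. They move every extension to one starting at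
the base point whose source is fixed, and allow the angle of the target to vary as long as it stays
in `(0, 2π)`. Hence the degree, together with the coordinates in which the endpoints agree,
determines the image of an extension in the pair component category.
-/

/-! ### Lifting angles to the line -/

lemma eq_of_circleExp_const {A : Type*} [TopologicalSpace A] [PreconnectedSpace A] {f : A → ℝ}
    (hf : Continuous f) {z : Circle} (h : ∀ a, Circle.exp (f a) = z) (a b : A) : f a = f b :=
  Circle.isCoveringMap_exp.const_of_comp hf (fun a b => (h a).trans (h b).symm) a b

lemma sub_eq_sub_of_circleExp_eq {A : Type*} [TopologicalSpace A] [PreconnectedSpace A]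
    {f g : A → ℝ} (hf : Continuous f) (hg : Continuous g)
    (h : ∀ a, Circle.exp (f a) = Circle.exp (g a)) (a b : A) : f a - f b = g a - g b := by
  have hconst := eq_of_circleExp_const (hf.sub hg) (z := 1)
    (fun a => by rw [Pi.sub_apply, Circle.exp_sub, h, div_self']) a b
  simp only [Pi.sub_apply] at hconst
  linarith

lemma exists_circleExp_homotopyLift {A : Type*} [TopologicalSpace A] {K : unitInterval × A → Circle}
    (hK : Continuous K) {f : A → ℝ} (hf : Continuous f) (h : ∀ a, K (0, a) = Circle.exp (f a)) :
    ∃ Θ : unitInterval × A → ℝ, Continuous Θ ∧ ∀ p, K p = Circle.exp (Θ p) :=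
  let Θ := Circle.isCoveringMap_exp.liftHomotopy ⟨K, hK⟩ ⟨f, hf⟩ h
  ⟨Θ, Θ.continuous, fun p =>
    (congrFun (Circle.isCoveringMap_exp.liftHomotopy_lifts ⟨K, hK⟩ ⟨f, hf⟩ h) p).symm⟩

lemma exists_continuousMap_circle_of_periodic {f : ℝ → ℝ} (hf : Continuous f)
    (h : Function.Periodic f (2 * Real.pi)) :
    ∃ δ : C(Circle, ℝ), ∀ s, δ (Circle.exp s) = f s := by
  have hq : Topology.IsQuotientMap Circle.exp :=
    Circle.isCoveringMap_exp.isQuotientMap Circle.exp_surjective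
  have hfib : ∀ s t, Circle.exp s = Circle.exp t → f s = f t := fun s t hst => by
    obtain ⟨m, rfl⟩ := Circle.exp_eq_exp.1 hst
    exact h.int_mul m t
  exact ⟨hq.lift ⟨f, hf⟩ hfib, fun s => DFunLike.congr_fun (hq.lift_comp ⟨f, hf⟩ hfib) s⟩

lemma angleDiff_eq_of_eq_mul_exp {z w : Circle} {a : ℝ} (h0 : 0 ≤ a) (h1 : a < 2 * Real.pi)
    (h : w = z * Circle.exp a) : Circle.angleDiff z w = a := by
  refine Circle.exp_injOn_Ico (a := 0) (b := 2 * Real.pi) (by simp)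
    ⟨Circle.angleDiff_nonneg _ _, Circle.angleDiff_lt_two_pi _ _⟩ ⟨h0, h1⟩ ?_
  rw [eq_comm, ← mul_right_inj z, ← h, mul_comm, Circle.exp_angleDiff_mul]

lemma angleDiff_self (z : Circle) : Circle.angleDiff z z = 0 :=
  angleDiff_eq_of_eq_mul_exp le_rfl Real.two_pi_pos (by simp)

lemma mul_exp_angleDiff (z w : Circle) : z * Circle.exp (Circle.angleDiff z w) = w := by
  rw [mul_comm, Circle.exp_angleDiff_mul]

/-! ### Lengths of classes of d-paths -/

/-- An identification of a d-space with the directed `n`-torus. Stating everything in terms of a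
chart treats the directed circle and the directed torus at once. -/
structure TorusChart {X : Type u} [TopologicalSpace X] (D : DStructure X) (n : ℕ) where
  toHomeomorph : X ≃ₜ (Fin n → Circle)
  mem_dpaths_iff : ∀ γ : C(unitInterval, X), γ ∈ D.dpaths ↔ ∀ i, ∃ g : C(unitInterval, ℝ),
    Monotone g ∧ ∀ t, toHomeomorph (γ t) i = Circle.exp (g t)

/-- The standard chart of the directed torus. -/
noncomputable def torusChart (n : ℕ) : TorusChart (dTorus n) n where
  toHomeomorph := Homeomorph.refl _
  mem_dpaths_iff _ := forall_congr' fun _ => exists_congr fun _ => and_congr_right fun _ =>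
    ⟨fun h t => congrArg (fun k => k t) h, fun h => ContinuousMap.ext h⟩

/-- The directed circle as a directed torus of dimension one. -/
noncomputable def circleChart : TorusChart dCircle 1 where
  toHomeomorph := (Homeomorph.funUnique (Fin 1) Circle).symm
  mem_dpaths_iff _ := by
    refine Iff.trans ?_ Fin.forall_fin_one.symm
    exact exists_congr fun _ => and_congr_right fun _ =>
      ⟨fun h t => congrArg (fun k => k t) h, fun h => ContinuousMap.ext h⟩

lemma FundHom.exists_rep {X : Type u} [TopologicalSpace X] {D : DStructure X} {x y : X}
    (σ : FundHom D x y) : ∃ p : DPath D x y, FundHom.mk p = σ := by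
  obtain ⟨a, rfl⟩ := ZerothHomotopy.mk_surjective σ
  obtain ⟨p, rfl⟩ := Quot.exists_rep a
  exact ⟨p, rfl⟩

lemma FundHom.mk_eq_mk_of_continuous {X : Type u} [TopologicalSpace X] {D : DStructure X} {x y : X}
    {P : unitInterval → DPath D x y} (hP : Continuous P) :
    FundHom.mk (P 0) = FundHom.mk (P 1) :=
  ZerothHomotopy.sound (x := Trace.mk (P 0)) (y := Trace.mk (P 1))
    { toFun := fun s => Trace.mk (P s)
      continuous_toFun := continuous_quot_mk.comp hP
      source' := rfl
      target' := rfl }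

namespace TorusChart

variable {X : Type u} [TopologicalSpace X] {D : DStructure X} {n : ℕ} (c : TorusChart D n)

/-- The `i`-th circle coordinate of a point. -/
noncomputable def coord (x : X) (i : Fin n) : Circle := c.toHomeomorph x i

@[fun_prop]
lemma continuous_coord (i : Fin n) : Continuous fun x => c.coord x i :=
  (continuous_apply i).comp c.toHomeomorph.continuous

/-- The point with given angular coordinates. -/
noncomputable def point (u : Fin n → ℝ) : X := c.toHomeomorph.symm fun i => Circle.exp (u i)

@[simp]
lemma coord_point (u : Fin n → ℝ) (i : Fin n) : c.coord (c.point u) i = Circle.exp (u i) := by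
  simp [coord, point]

@[fun_prop]
lemma continuous_point : Continuous c.point :=
  c.toHomeomorph.symm.continuous.comp (by fun_prop)

lemma coord_ext {x y : X} (h : ∀ i, c.coord x i = c.coord y i) : x = y :=
  c.toHomeomorph.injective (funext h)

lemma exists_point (x : X) : ∃ u, c.point u = x :=
  ⟨fun i => Complex.arg (c.coord x i), c.coord_ext fun i => by simp [Circle.exp_arg]⟩

lemma exists_lift {x y : X} (p : DPath D x y) (i : Fin n) : ∃ g : C(unitInterval, ℝ),
    Monotone g ∧ ∀ t, c.coord (p.1 t) i = Circle.exp (g t) :=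
  (c.mem_dpaths_iff _).1 p.2 i

/-- The angle swept by the `i`-th coordinate of a d-path. -/
noncomputable def pathLen {x y : X} (p : DPath D x y) (i : Fin n) : ℝ :=
  (c.exists_lift p i).choose 1 - (c.exists_lift p i).choose 0

lemma pathLen_eq {x y : X} (p : DPath D x y) (i : Fin n) {g : unitInterval → ℝ}
    (hg : Continuous g) (h : ∀ t, c.coord (p.1 t) i = Circle.exp (g t)) :
    c.pathLen p i = g 1 - g 0 :=
  sub_eq_sub_of_circleExp_eq (c.exists_lift p i).choose.continuous hg
    (fun t => ((c.exists_lift p i).choose_spec.2 t).symm.trans (h t)) 1 0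

lemma pathLen_nonneg {x y : X} (p : DPath D x y) (i : Fin n) : 0 ≤ c.pathLen p i :=
  sub_nonneg.2 ((c.exists_lift p i).choose_spec.1 unitInterval.nonneg')

lemma mul_exp_pathLen {x y : X} (p : DPath D x y) (i : Fin n) :
    c.coord x i * Circle.exp (c.pathLen p i) = c.coord y i := by
  obtain ⟨g, -, hg⟩ := c.exists_lift p i
  have hx : c.coord x i = Circle.exp (g 0) := by rw [← hg, p.1.source]
  have hy : c.coord y i = Circle.exp (g 1) := by rw [← hg, p.1.target]
  rw [c.pathLen_eq p i g.continuous hg, hx, hy, ← Circle.exp_add, add_sub_cancel]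

lemma continuous_pathLen (x y : X) (i : Fin n) :
    Continuous fun p : DPath D x y => c.pathLen p i := by
  have hval : Continuous fun p : DPath D x y => p.1.toContinuousMap :=
    continuous_induced_dom.comp continuous_subtype_val
  have heval : Continuous fun q : unitInterval × DPath D x y => q.2.1 q.1 :=
    ContinuousEval.continuous_eval.comp ((hval.comp continuous_snd).prodMk continuous_fst)
  obtain ⟨Θ, hΘ, h⟩ := exists_circleExp_homotopyLift ((c.continuous_coord i).comp heval)
    (f := fun _ => Complex.arg (c.coord x i)) continuous_const
    (fun p => by simp [Circle.exp_arg, p.1.source])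
  have hlen : (fun p : DPath D x y => c.pathLen p i) = fun p => Θ (1, p) - Θ (0, p) :=
    funext fun p => c.pathLen_eq p i (g := fun t => Θ (t, p)) (by fun_prop) fun t => h (t, p)
  rw [hlen]
  fun_prop

lemma pathLen_eq_of_isReparam {x y : X} {p q : DPath D x y} (h : p.IsReparam q) (i : Fin n) :
    c.pathLen p i = c.pathLen q i := by
  obtain ⟨φ, hφ, hsurj, hq⟩ := h
  obtain ⟨g, -, hg⟩ := c.exists_lift p i
  obtain ⟨h0, h1⟩ := reparam_ends hφ hsurj
  rw [c.pathLen_eq p i g.continuous hg,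
    c.pathLen_eq q i (g := g ∘ φ) (by fun_prop) fun t => by rw [hq, hg, Function.comp_apply],
    Function.comp_apply, Function.comp_apply, h0, h1]

/-- The angular length of a trace. -/
noncomputable def traceLen {x y : X} (σ : Trace D x y) (i : Fin n) : ℝ :=
  Quot.lift (fun p => c.pathLen p i) (fun _ _ h => c.pathLen_eq_of_isReparam h i) σ

lemma continuous_traceLen (x y : X) (i : Fin n) :
    Continuous fun σ : Trace D x y => c.traceLen σ i :=
  continuous_quot_lift _ (c.continuous_pathLen x y i)

lemma mul_exp_traceLen {x y : X} (σ : Trace D x y) (i : Fin n) :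
    c.coord x i * Circle.exp (c.traceLen σ i) = c.coord y i := by
  obtain ⟨p, rfl⟩ := Quot.exists_rep σ
  exact c.mul_exp_pathLen p i

lemma traceLen_eq_of_path {x y : X} {σ τ : Trace D x y} (γ : Path σ τ) (i : Fin n) :
    c.traceLen σ i = c.traceLen τ i := by
  have hconst := eq_of_circleExp_const ((c.continuous_traceLen x y i).comp γ.continuous)
    (z := c.coord y i / c.coord x i)
    (fun t => eq_div_of_mul_eq'' (c.mul_exp_traceLen (γ t) i)) 0 1
  simpa only [Function.comp_apply, γ.source, γ.target] using hconst

/-- The angular length of a morphism of the fundamental category. -/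
noncomputable def len {x y : X} (σ : FundHom D x y) (i : Fin n) : ℝ :=
  ZerothHomotopy.lift (fun a => c.traceLen a i) (fun _ _ γ => c.traceLen_eq_of_path γ i) σ

@[simp]
lemma len_mk {x y : X} (p : DPath D x y) (i : Fin n) :
    c.len (FundHom.mk p) i = c.pathLen p i := rfl

lemma len_nonneg {x y : X} (σ : FundHom D x y) (i : Fin n) : 0 ≤ c.len σ i := by
  obtain ⟨p, rfl⟩ := σ.exists_rep
  exact c.pathLen_nonneg p i

lemma mul_exp_len {x y : X} (σ : FundHom D x y) (i : Fin n) :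
    c.coord x i * Circle.exp (c.len σ i) = c.coord y i := by
  obtain ⟨p, rfl⟩ := σ.exists_rep
  exact c.mul_exp_pathLen p i

@[simp]
lemma len_refl (x : X) (i : Fin n) : c.len (FundHom.refl x : FundHom D x x) i = 0 :=
  (c.pathLen_eq (DPath.refl x) i (g := fun _ => Complex.arg (c.coord x i)) continuous_const
    fun _ => (Circle.exp_arg _).symm).trans (sub_self _)

@[simp]
lemma len_trans {x y z : X} (σ : FundHom D x y) (τ : FundHom D y z) (i : Fin n) :
    c.len (σ.trans τ) i = c.len σ i + c.len τ i := by
  obtain ⟨p, rfl⟩ := σ.exists_rep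
  obtain ⟨q, rfl⟩ := τ.exists_rep
  obtain ⟨g, -, hg⟩ := c.exists_lift p i
  obtain ⟨k, -, hk⟩ := c.exists_lift q i
  have hexp : Circle.exp (k 0) = Circle.exp (g 1) := by
    rw [← hg, ← hk, p.1.target, q.1.source]
  let a : Path (g 0) (g 1) := ⟨g, rfl, rfl⟩
  let b : Path (g 1) (k 1 - k 0 + g 1) :=
    ⟨⟨fun t => k t - k 0 + g 1, by fun_prop⟩, by simp, rfl⟩
  have hlift : ∀ t, c.coord ((p.1.trans q.1) t) i = Circle.exp ((a.trans b) t) := fun t => by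
    rw [Path.trans_apply, Path.trans_apply]
    split_ifs
    · exact hg _
    · simp [b, hk, Circle.exp_add, Circle.exp_sub, hexp]
  change c.pathLen (p.trans q) i = c.pathLen p i + c.pathLen q i
  rw [c.pathLen_eq p i g.continuous hg, c.pathLen_eq q i k.continuous hk,
    c.pathLen_eq (p.trans q) i (a.trans b).continuous hlift, (a.trans b).source, (a.trans b).target]
  ring

lemma len_map {Y : Type v} [TopologicalSpace Y] {E : DStructure Y} {m : ℕ} (b : TorusChart E m)
    {f : C(X, Y)} (hf : IsDMap D E f) {x y : X} {x' y' : Y} (hx : f x = x') (hy : f y = y')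
    {i : Fin n} {j : Fin m} {θ : X → ℝ} (hθ : Continuous θ)
    (h : ∀ x, b.coord (f x) j = c.coord x i * Circle.exp (θ x)) (σ : FundHom D x y) :
    b.len (FundHom.map f hf hx hy σ) j = c.len σ i + θ y - θ x := by
  obtain ⟨p, rfl⟩ := σ.exists_rep
  obtain ⟨g, -, hg⟩ := c.exists_lift p i
  change b.pathLen (DPath.map f hf hx hy p) j = c.pathLen p i + θ y - θ x
  rw [c.pathLen_eq p i g.continuous hg,
    b.pathLen_eq _ j (g := fun t => g t + θ (p.1 t)) (by fun_prop)
      fun t => (h (p.1 t)).trans (by rw [hg, ← Circle.exp_add]), p.1.source, p.1.target]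
  ring

/-- The d-path with given non-decreasing angular coordinates. -/
noncomputable def pathOfLift {x y : X} (g : C(unitInterval, Fin n → ℝ)) (hm : Monotone g)
    (h0 : c.point (g 0) = x) (h1 : c.point (g 1) = y) : DPath D x y :=
  ⟨{ toFun := fun t => c.point (g t)
     source' := h0
     target' := h1 }, (c.mem_dpaths_iff _).2 fun i => ⟨⟨fun t => g t i, by fun_prop⟩,
      fun _ _ hst => hm hst i, fun t => c.coord_point (g t) i⟩⟩

lemma pathLen_pathOfLift {x y : X} (g : C(unitInterval, Fin n → ℝ)) (hm : Monotone g)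
    (h0 : c.point (g 0) = x) (h1 : c.point (g 1) = y) (i : Fin n) :
    c.pathLen (c.pathOfLift g hm h0 h1) i = g 1 i - g 0 i :=
  c.pathLen_eq _ i (g := fun t => g t i) (by fun_prop) fun t => c.coord_point (g t) i

lemma exists_pathOfLift_eq {u : Fin n → ℝ} {y : X} (p : DPath D (c.point u) y) :
    ∃ (g : C(unitInterval, Fin n → ℝ)) (hm : Monotone g) (h0 : c.point (g 0) = c.point u)
      (h1 : c.point (g 1) = y), g 0 = u ∧ c.pathOfLift g hm h0 h1 = p := by
  choose k hk hkp using c.exists_lift p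
  have hexp : ∀ i, Circle.exp (k i 0) = Circle.exp (u i) := fun i => by
    rw [← hkp, p.1.source, coord_point]
  let g : C(unitInterval, Fin n → ℝ) := ⟨fun t i => k i t - k i 0 + u i, by fun_prop⟩
  have hg : ∀ t, c.point (g t) = p.1 t := fun t => c.coord_ext fun i => by
    simp [g, hkp, Circle.exp_add, Circle.exp_sub, hexp]
  refine ⟨g, fun s t hst i => ?_, (hg 0).trans p.1.source, (hg 1).trans p.1.target,
    by ext; simp [g], Subtype.ext (Path.ext (funext hg))⟩
  exact add_le_add_left (sub_le_sub_right (hk i hst) _) _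

lemma mk_pathOfLift_eq_mk_pathOfLift {x y : X} {g k : C(unitInterval, Fin n → ℝ)}
    (hg : Monotone g) (hk : Monotone k) (hg0 : c.point (g 0) = x) (hg1 : c.point (g 1) = y)
    (hk0 : c.point (k 0) = x) (hk1 : c.point (k 1) = y) (h0 : g 0 = k 0) (h1 : g 1 = k 1) :
    FundHom.mk (c.pathOfLift g hg hg0 hg1) = FundHom.mk (c.pathOfLift k hk hk0 hk1) := by
  let G (s : unitInterval) : C(unitInterval, Fin n → ℝ) :=
    ⟨fun t => (1 - (s : ℝ)) • g t + (s : ℝ) • k t, by fun_prop⟩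
  have hG : ∀ s, Monotone (G s) := fun s =>
    (hg.const_smul (sub_nonneg.2 s.2.2)).add (hk.const_smul s.2.1)
  have hend : ∀ s t, g t = k t → G s t = g t := fun s t h => by
    simp [G, ← h, ← add_smul]
  let P (s : unitInterval) : DPath D x y := c.pathOfLift (G s) (hG s)
    (by rw [hend s 0 h0, hg0]) (by rw [hend s 1 h1, hg1])
  have hP : Continuous P := by
    refine Continuous.subtype_mk (continuous_induced_rng.2 ?_) _
    refine ContinuousMap.continuous_of_continuous_uncurry _ (c.continuous_point.comp ?_)
    change Continuous fun q : unitInterval × unitInterval =>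
      (1 - (q.1 : ℝ)) • g q.2 + (q.1 : ℝ) • k q.2
    fun_prop
  have hG0 : G 0 = g := by ext; simp [G]
  have hG1 : G 1 = k := by ext; simp [G]
  simpa only [P, hG0, hG1] using FundHom.mk_eq_mk_of_continuous hP

lemma hom_ext {x y : X} {σ τ : FundHom D x y} (h : ∀ i, c.len σ i = c.len τ i) : σ = τ := by
  obtain ⟨u, rfl⟩ := c.exists_point x
  obtain ⟨p, rfl⟩ := σ.exists_rep
  obtain ⟨q, rfl⟩ := τ.exists_rep
  obtain ⟨g, hg, hg0, hg1, hgu, rfl⟩ := c.exists_pathOfLift_eq p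
  obtain ⟨k, hk, hk0, hk1, hku, rfl⟩ := c.exists_pathOfLift_eq q
  refine c.mk_pathOfLift_eq_mk_pathOfLift hg hk hg0 hg1 hk0 hk1 (hgu.trans hku.symm) ?_
  ext i
  have hi := h i
  simp only [len_mk, pathLen_pathOfLift, hgu, hku] at hi
  linarith

lemma exists_len_eq {x y : X} {L : Fin n → ℝ} (hL : 0 ≤ L)
    (h : ∀ i, c.coord x i * Circle.exp (L i) = c.coord y i) :
    ∃ σ : FundHom D x y, c.len σ = L := by
  obtain ⟨u, rfl⟩ := c.exists_point x
  let g : C(unitInterval, Fin n → ℝ) := ⟨fun t => u + (t : ℝ) • L, by fun_prop⟩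
  have hg : Monotone g := fun s t hst => by
    have : (s : ℝ) ≤ t := hst
    simp only [g, ContinuousMap.coe_mk]
    gcongr
  refine ⟨FundHom.mk (c.pathOfLift g hg (by simp [g]) (c.coord_ext fun i => ?_)), ?_⟩
  · simp [g, ← h, Circle.exp_add]
  · ext i
    rw [len_mk, pathLen_pathOfLift]
    simp [g]

end TorusChart

/-! ### Angular shifts of the circle -/

/-- A continuous angle function `δ` on the circle such that `z ↦ z * exp (δ z)` lifts to a strictly
increasing function on the line. It encodes a directed homeomorphism of the circle together with a
lift to the line. -/
structure AngularShift where
  angle : C(Circle, ℝ)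
  strictMono : StrictMono fun s => s + angle (Circle.exp s)

namespace AngularShift

noncomputable instance : CoeFun AngularShift fun _ => Circle → ℝ := ⟨fun δ => δ.angle⟩

@[fun_prop]
lemma continuous (δ : AngularShift) : Continuous δ := δ.angle.continuous

/-- The rotation by a fixed angle. -/
noncomputable def const (a : ℝ) : AngularShift where
  angle := .const _ a
  strictMono _ _ hst := add_lt_add_left hst a

@[simp]
lemma const_apply (a : ℝ) (z : Circle) : const a z = a := rfl

/-- The shift `δ` followed by the rotation by the angle `a`. -/
noncomputable def addConst (δ : AngularShift) (a : ℝ) : AngularShift where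
  angle := δ.angle + .const _ a
  strictMono s t hst := by
    simpa only [ContinuousMap.add_apply, ContinuousMap.const_apply, ← add_assoc]
      using add_lt_add_left (δ.strictMono hst) a

@[simp]
lemma addConst_apply (δ : AngularShift) (a : ℝ) (z : Circle) : δ.addConst a z = δ z + a := rfl

/-- The linear interpolation between two shifts. -/
noncomputable def lerp (δ ε : AngularShift) (t : unitInterval) : AngularShift where
  angle := ⟨fun z => (1 - (t : ℝ)) * δ z + t * ε z, by fun_prop⟩
  strictMono r s hrs := by
    have hconv := convex_Ioi (0 : ℝ) (sub_pos.2 (δ.strictMono hrs)) (sub_pos.2 (ε.strictMono hrs))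
      (sub_nonneg.2 t.2.2) t.2.1 (sub_add_cancel _ _)
    simp only [smul_eq_mul, Set.mem_Ioi] at hconv
    simp only [ContinuousMap.coe_mk]
    linarith

@[simp]
lemma lerp_apply (δ ε : AngularShift) (t : unitInterval) (z : Circle) :
    lerp δ ε t z = (1 - (t : ℝ)) * δ z + t * ε z := rfl

lemma angleDiff_shift (δ : AngularShift) (z w : Circle) :
    Circle.angleDiff (z * Circle.exp (δ z)) (w * Circle.exp (δ w)) =
      Circle.angleDiff z w + δ w - δ z := by
  have hw := mul_exp_angleDiff z w
  obtain ⟨s, rfl⟩ := Circle.exp_surjective z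
  rw [← Circle.exp_add] at hw
  have hle := δ.strictMono.monotone
    (le_add_of_nonneg_right (a := s) (Circle.angleDiff_nonneg (Circle.exp s) w))
  have hlt := δ.strictMono (add_lt_add_right (Circle.angleDiff_lt_two_pi (Circle.exp s) w) s)
  simp only [hw, Circle.exp_add_two_pi] at hle hlt
  refine angleDiff_eq_of_eq_mul_exp (by linarith) (by linarith) ?_
  rw [Circle.exp_sub, Circle.exp_add, mul_assoc, mul_div_cancel, ← mul_assoc, mul_exp_angleDiff]

lemma surjective_lift (δ : AngularShift) :
    Function.Surjective fun s => s + δ (Circle.exp s) := by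
  obtain ⟨b, hb⟩ := (isCompact_range δ.continuous).bddBelow
  obtain ⟨B, hB⟩ := (isCompact_range δ.continuous).bddAbove
  exact Continuous.surjective (by fun_prop)
    (Filter.tendsto_atTop_add_right_of_le _ b Filter.tendsto_id fun s => hb ⟨_, rfl⟩)
    (Filter.tendsto_atBot_add_right_of_ge _ B Filter.tendsto_id fun s => hB ⟨_, rfl⟩)

lemma exists_inverse (δ : AngularShift) : ∃ ε : AngularShift,
    (∀ z, ε (z * Circle.exp (δ z)) = -δ z) ∧ ∀ z, δ (z * Circle.exp (ε z)) = -ε z := by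
  let o : ℝ ≃o ℝ := δ.strictMono.orderIsoOfSurjective _ δ.surjective_lift
  have ho : ∀ s, o s = s + δ (Circle.exp s) := fun _ => rfl
  have hper : ∀ s, o.symm (s + 2 * Real.pi) = o.symm s + 2 * Real.pi := fun s => by
    rw [OrderIso.symm_apply_eq, ho, Circle.exp_add_two_pi, add_right_comm, ← ho,
      OrderIso.apply_symm_apply]
  obtain ⟨ε, hε⟩ := exists_continuousMap_circle_of_periodic (f := fun s => o.symm s - s)
    (o.symm.continuous.sub continuous_id) (fun s => by simp only [hper, add_sub_add_right_eq_sub])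
  refine ⟨⟨ε, by simpa [hε] using o.symm.strictMono⟩, fun z => ?_, fun z => ?_⟩
  · obtain ⟨s, rfl⟩ := Circle.exp_surjective z
    rw [← Circle.exp_add, ← ho, hε, OrderIso.symm_apply_apply, ho, sub_add_cancel_left]
  · obtain ⟨s, rfl⟩ := Circle.exp_surjective z
    have hos := ho (o.symm s)
    rw [OrderIso.apply_symm_apply] at hos
    rw [hε, ← Circle.exp_add, add_sub_cancel, neg_sub]
    exact eq_sub_of_add_eq' hos.symm

/-- The shift that undoes a shift. -/
noncomputable def symm (δ : AngularShift) : AngularShift := δ.exists_inverse.choose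

@[simp]
lemma symm_shift (δ : AngularShift) (z : Circle) : δ.symm (z * Circle.exp (δ z)) = -δ z :=
  δ.exists_inverse.choose_spec.1 z

@[simp]
lemma shift_symm (δ : AngularShift) (z : Circle) : δ (z * Circle.exp (δ.symm z)) = -δ.symm z :=
  δ.exists_inverse.choose_spec.2 z

/-- The homeomorphism `z ↦ z * exp (δ z)` of the circle. -/
noncomputable def toHomeomorph (δ : AngularShift) : Circle ≃ₜ Circle where
  toFun z := z * Circle.exp (δ z)
  invFun z := z * Circle.exp (δ.symm z)
  left_inv z := by simp
  right_inv z := by simp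
  continuous_toFun := by fun_prop
  continuous_invFun := by fun_prop

lemma isDMap_toHomeomorph (δ : AngularShift) :
    IsDMap dCircle dCircle (δ.toHomeomorph : C(Circle, Circle)) := by
  rintro _ ⟨g, hg, rfl⟩
  refine ⟨⟨fun t => g t + δ (Circle.exp (g t)), by fun_prop⟩, δ.strictMono.monotone.comp hg, ?_⟩
  ext t
  simp [toHomeomorph, Circle.exp_add]

lemma isDMap_toHomeomorph_symm (δ : AngularShift) :
    IsDMap dCircle dCircle (δ.toHomeomorph.symm : C(Circle, Circle)) :=
  δ.symm.isDMap_toHomeomorph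

end AngularShift

/-! ### Path space preserving maps -/

section PathSpacePreserving

variable {X : Type u} [TopologicalSpace X] {𝓕 : EquivalenceFamily.{u}} {D : DStructure X}

lemma traceMap_eq_id {f : C(X, X)} (hf : IsDMap D D f) (hid : f = ContinuousMap.id X) {x y : X}
    (hx : f x = x) (hy : f y = y) : traceMap f hf hx hy = ContinuousMap.id (Trace D x y) := by
  subst hid
  ext σ
  obtain ⟨p, rfl⟩ := Quot.exists_rep σ
  rfl

lemma traceMap_comp_traceMap {f g : C(X, X)} (hf : IsDMap D D f) (hg : IsDMap D D g)
    {x y x' y' x'' y'' : X} (hx : f x = x') (hy : f y = y') (hx' : g x' = x'') (hy' : g y' = y'') :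
    (traceMap g hg hx' hy').comp (traceMap f hf hx hy) =
      traceMap (g.comp f) (hg.comp hf) ((congrArg g hx).trans hx') ((congrArg g hy).trans hy') := by
  ext σ
  obtain ⟨p, rfl⟩ := Quot.exists_rep σ
  rfl

lemma isPsp_of_inverse (𝓕 : EquivalenceFamily.{u}) {f g : C(X, X)} (hf : IsDMap D D f)
    (hg : IsDMap D D g) (hgf : g.comp f = ContinuousMap.id X)
    (hfg : f.comp g = ContinuousMap.id X) : IsPsp 𝓕 D f := by
  have hleft : ∀ x, g (f x) = x := DFunLike.congr_fun hgf
  refine ⟨hf, fun p => 𝓕.isEquiv_of_homotopyEquiv _ (traceMap g hg (hleft _) (hleft _)) ?_ ?_⟩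
  · rw [traceMap_comp_traceMap, traceMap_eq_id _ hgf]
  · rw [traceMap_comp_traceMap, traceMap_eq_id _ hfg]

lemma IsPsp.surjective_map {f : C(X, X)} (h : IsPsp 𝓕 D f) (p : RPair D) :
    Function.Surjective (FundHom.map (x := p.src) (y := p.tgt) f h.1 rfl rfl) :=
  (𝓕.bijective_of_isEquiv _ (h.2 p)).2

lemma homotopic_level_zero_level_one (H : C(X × unitInterval, X)) :
    (level H 0).Homotopic (level H 1) :=
  ⟨⟨H.comp ⟨Prod.swap, continuous_swap⟩, fun _ => rfl, fun _ => rfl⟩⟩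

lemma IsInessential.homotopic_id_and_isPsp {α : Flavour} {f : C(X, X)} {p q : RPair D}
    (hf : IsInessential 𝓕 D α f p q) : (ContinuousMap.id X).Homotopic f ∧ IsPsp 𝓕 D f := by
  obtain ⟨-, -, hf⟩ := hf
  cases α with
  | past =>
    obtain ⟨H, -, hpsp, rfl, h1⟩ := hf
    exact ⟨h1 ▸ (homotopic_level_zero_level_one H).symm, hpsp 0⟩
  | future | neutral =>
    obtain ⟨H, -, hpsp, h0, rfl⟩ := hf
    exact ⟨h0 ▸ homotopic_level_zero_level_one H, hpsp 1⟩
  | total =>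
    obtain ⟨⟨H, -, hpsp, h0, rfl⟩, -⟩ := hf
    exact ⟨h0 ▸ homotopic_level_zero_level_one H, hpsp 1⟩

end PathSpacePreserving

/-! ### Shifts of the torus -/

namespace TorusChart

variable {X : Type u} [TopologicalSpace X] {D : DStructure X} {n : ℕ} (c : TorusChart D n)

/-- The homotopy `(x, t) ↦ x * exp ((1 - t) * δ x + t * ε x)` that interpolates between the shifts
of the coordinates by `δ` and by `ε`. -/
noncomputable def shiftHomotopy (δ ε : Fin n → AngularShift) : C(X × unitInterval, X) where
  toFun q := c.toHomeomorph.symm fun i =>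
    c.coord q.1 i * Circle.exp ((δ i).lerp (ε i) q.2 (c.coord q.1 i))
  continuous_toFun := c.toHomeomorph.symm.continuous.comp (by
    simp only [AngularShift.lerp_apply]
    fun_prop)

@[simp]
lemma coord_shiftHomotopy (δ ε : Fin n → AngularShift) (q : X × unitInterval) (i : Fin n) :
    c.coord (c.shiftHomotopy δ ε q) i =
      c.coord q.1 i * Circle.exp ((δ i).lerp (ε i) q.2 (c.coord q.1 i)) :=
  congrFun (c.toHomeomorph.apply_symm_apply _) i

/-- The map that shifts the `i`-th coordinate by `δ i`. -/
noncomputable def shiftMap (δ : Fin n → AngularShift) : C(X, X) where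
  toFun x := c.toHomeomorph.symm fun i => c.coord x i * Circle.exp (δ i (c.coord x i))
  continuous_toFun := c.toHomeomorph.symm.continuous.comp (by fun_prop)

@[simp]
lemma coord_shiftMap (δ : Fin n → AngularShift) (x : X) (i : Fin n) :
    c.coord (c.shiftMap δ x) i = c.coord x i * Circle.exp (δ i (c.coord x i)) :=
  congrFun (c.toHomeomorph.apply_symm_apply _) i

lemma shiftMap_const_zero : c.shiftMap (fun _ => .const 0) = ContinuousMap.id X := by
  ext x
  exact c.coord_ext fun i => by simp

lemma shiftMap_comp_shiftMap_symm (δ : Fin n → AngularShift) :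
    (c.shiftMap δ).comp (c.shiftMap fun i => (δ i).symm) = ContinuousMap.id X := by
  ext x
  exact c.coord_ext fun i => by simp

lemma shiftMap_symm_comp_shiftMap (δ : Fin n → AngularShift) :
    (c.shiftMap fun i => (δ i).symm).comp (c.shiftMap δ) = ContinuousMap.id X := by
  ext x
  exact c.coord_ext fun i => by simp

lemma shiftMap_addConst (δ : Fin n → AngularShift) (k : Fin n → ℤ) :
    c.shiftMap (fun i => (δ i).addConst (k i * (2 * Real.pi))) = c.shiftMap δ := by
  ext x
  exact c.coord_ext fun i => by simp [Circle.exp_add]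

lemma exists_nonneg_shiftMap_eq (δ : Fin n → AngularShift) :
    ∃ ε : Fin n → AngularShift, (∀ i z, 0 ≤ ε i z) ∧ c.shiftMap ε = c.shiftMap δ := by
  choose b hb using fun i => (isCompact_range (δ i).continuous).bddBelow
  choose k hk using fun i => exists_int_gt (-b i / (2 * Real.pi))
  refine ⟨_, fun i z => ?_, c.shiftMap_addConst δ k⟩
  have hbz : b i ≤ δ i z := hb i ⟨z, rfl⟩
  have hbk := (div_lt_iff₀ Real.two_pi_pos).1 (hk i)
  simp only [AngularShift.addConst_apply]
  linarith

lemma exists_nonpos_shiftMap_eq (δ : Fin n → AngularShift) :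
    ∃ ε : Fin n → AngularShift, (∀ i z, ε i z ≤ 0) ∧ c.shiftMap ε = c.shiftMap δ := by
  choose b hb using fun i => (isCompact_range (δ i).continuous).bddAbove
  choose k hk using fun i => exists_int_lt (-b i / (2 * Real.pi))
  refine ⟨_, fun i z => ?_, c.shiftMap_addConst δ k⟩
  have hbz : δ i z ≤ b i := hb i ⟨z, rfl⟩
  have hbk := (lt_div_iff₀ Real.two_pi_pos).1 (hk i)
  simp only [AngularShift.addConst_apply]
  linarith

lemma level_shiftHomotopy (δ ε : Fin n → AngularShift) (t : unitInterval) :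
    level (c.shiftHomotopy δ ε) t = c.shiftMap fun i => (δ i).lerp (ε i) t := rfl

lemma level_shiftHomotopy_zero (δ ε : Fin n → AngularShift) :
    level (c.shiftHomotopy δ ε) 0 = c.shiftMap δ := by
  ext x
  exact c.coord_ext fun i => by simp [level]

lemma level_shiftHomotopy_one (δ ε : Fin n → AngularShift) :
    level (c.shiftHomotopy δ ε) 1 = c.shiftMap ε := by
  ext x
  exact c.coord_ext fun i => by simp [level]

lemma shiftHomotopy_comp_mem_dpaths (δ ε : Fin n → AngularShift)
    {γ : C(unitInterval, X × unitInterval)} (hγ : ContinuousMap.fst.comp γ ∈ D.dpaths)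
    (h : ∀ i z, Monotone fun t => (δ i).lerp (ε i) (γ t).2 z) :
    (c.shiftHomotopy δ ε).comp γ ∈ D.dpaths := by
  refine (c.mem_dpaths_iff _).2 fun i => ?_
  obtain ⟨g, hg, hγg⟩ := (c.mem_dpaths_iff _).1 hγ i
  refine ⟨⟨fun t => g t + (δ i).lerp (ε i) (γ t).2 (Circle.exp (g t)), ?_⟩,
    fun s t hst => ?_, fun t => ?_⟩
  · simp only [AngularShift.lerp_apply]
    fun_prop
  · exact (((δ i).lerp (ε i) (γ s).2).strictMono.monotone (hg hst)).trans
      (add_le_add_right (h i _ hst) _)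
  · refine (c.coord_shiftHomotopy δ ε (γ t) i).trans ?_
    rw [show c.coord (γ t).1 i = Circle.exp (g t) from hγg t, ← Circle.exp_add]
    rfl

lemma isDihomotopy_shiftHomotopy (δ ε : Fin n → AngularShift) :
    IsDihomotopy D (c.shiftHomotopy δ ε) := fun _ hγ =>
  c.shiftHomotopy_comp_mem_dpaths δ ε hγ.1 fun i z s t _ =>
    le_of_eq (congrArg (fun r => (δ i).lerp (ε i) r z) (hγ.2 s t))

lemma isSimpleDHomotopy_shiftHomotopy {δ ε : Fin n → AngularShift} (h : ∀ i z, δ i z ≤ ε i z) :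
    IsSimpleDHomotopy D (c.shiftHomotopy δ ε) := fun γ hγ =>
  c.shiftHomotopy_comp_mem_dpaths δ ε hγ.1 fun i z s t hst => by
    have hle : ((γ s).2 : ℝ) ≤ (γ t).2 := hγ.2 hst
    simp only [AngularShift.lerp_apply]
    linarith [mul_nonneg (sub_nonneg.2 hle) (sub_nonneg.2 (h i z))]

lemma isDMap_shiftMap (δ : Fin n → AngularShift) : IsDMap D D (c.shiftMap δ) := fun γ hγ => by
  rw [← c.level_shiftHomotopy_zero δ δ]
  exact c.isDihomotopy_shiftHomotopy δ δ (γ.prodMk (.const _ 0)) ⟨hγ, fun _ _ => rfl⟩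

variable (𝓕 : EquivalenceFamily.{u})

lemma isPsp_shiftMap (δ : Fin n → AngularShift) : IsPsp 𝓕 D (c.shiftMap δ) :=
  isPsp_of_inverse 𝓕 (c.isDMap_shiftMap δ) (c.isDMap_shiftMap _)
    (c.shiftMap_symm_comp_shiftMap δ) (c.shiftMap_comp_shiftMap_symm δ)

lemma isPsp_level_shiftHomotopy (δ ε : Fin n → AngularShift) (t : unitInterval) :
    IsPsp 𝓕 D (level (c.shiftHomotopy δ ε) t) := by
  rw [level_shiftHomotopy]
  exact c.isPsp_shiftMap 𝓕 _

lemma isNeutralInessential_shiftMap (δ : Fin n → AngularShift) :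
    IsNeutralInessential 𝓕 D (c.shiftMap δ) :=
  ⟨_, c.isDihomotopy_shiftHomotopy (fun _ => .const 0) δ, c.isPsp_level_shiftHomotopy 𝓕 _ _,
    by rw [level_shiftHomotopy_zero, shiftMap_const_zero], c.level_shiftHomotopy_one _ _⟩

lemma isFutureInessential_shiftMap (δ : Fin n → AngularShift) :
    IsFutureInessential 𝓕 D (c.shiftMap δ) := by
  obtain ⟨ε, hε, hεδ⟩ := c.exists_nonneg_shiftMap_eq δ
  exact ⟨_, c.isSimpleDHomotopy_shiftHomotopy (δ := fun _ => .const 0) hε,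
    c.isPsp_level_shiftHomotopy 𝓕 _ _, by rw [level_shiftHomotopy_zero, shiftMap_const_zero],
    by rw [level_shiftHomotopy_one, hεδ]⟩

lemma isPastInessential_shiftMap (δ : Fin n → AngularShift) :
    IsPastInessential 𝓕 D (c.shiftMap δ) := by
  obtain ⟨ε, hε, hεδ⟩ := c.exists_nonpos_shiftMap_eq δ
  exact ⟨_, c.isSimpleDHomotopy_shiftHomotopy (ε := fun _ => .const 0) hε,
    c.isPsp_level_shiftHomotopy 𝓕 _ _, by rw [level_shiftHomotopy_zero, hεδ],
    by rw [level_shiftHomotopy_one, shiftMap_const_zero]⟩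

lemma isInessential_shiftMap (α : Flavour) (δ : Fin n → AngularShift) {p q : RPair D}
    (hs : c.shiftMap δ p.src = q.src) (ht : c.shiftMap δ p.tgt = q.tgt) :
    IsInessential 𝓕 D α (c.shiftMap δ) p q := by
  refine ⟨hs, ht, ?_⟩
  cases α with
  | future => exact c.isFutureInessential_shiftMap 𝓕 δ
  | past => exact c.isPastInessential_shiftMap 𝓕 δ
  | neutral => exact c.isNeutralInessential_shiftMap 𝓕 δ
  | total =>
    have hid := c.shiftMap_symm_comp_shiftMap δ
    have hfix : ∀ x, ((c.shiftMap fun i => (δ i).symm).comp (c.shiftMap δ)) x = x :=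
      DFunLike.congr_fun hid
    refine ⟨c.isFutureInessential_shiftMap 𝓕 δ, _, c.isPastInessential_shiftMap 𝓕 _,
      (c.isDMap_shiftMap _).comp (c.isDMap_shiftMap δ), hfix _, hfix _,
      𝓕.isHomotopicToId_of_homotopic _ ?_⟩
    rw [traceMap_eq_id _ hid]

end TorusChart

/-! ### Inessential maps of the torus are products of shifts -/

lemma le_of_apply_le_of_translation {ι : Type*} [Finite ι] {F : (ι → ℝ) → ι → ℝ} {P : ℝ}
    (hP : 0 < P)
    (htrans : ∀ u (k : ι → ℕ), F (u + fun j => k j * P) = F u + fun j => k j * P)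
    (hrefl : ∀ u v, F u ≤ F v → u ≤ v) {u v : ι → ℝ} {i : ι} (h : F u i ≤ F v i) : u i ≤ v i := by
  classical
  obtain ⟨N, hN⟩ : ∃ N : ℕ, ∀ j, F u j ≤ F v j + N * P := by
    have hlarge : ∀ᶠ N : ℕ in Filter.atTop, ∀ j, F u j ≤ F v j + N * P :=
      Filter.eventually_all.2 fun j => (Filter.tendsto_atTop_add_const_left _ _
        (tendsto_natCast_atTop_atTop.atTop_mul_const hP)).eventually_ge_atTop _
    exact hlarge.exists
  have hle : F u ≤ F (v + fun j => (if j = i then 0 else N : ℕ) * P) := fun j => by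
    rw [htrans, Pi.add_apply]
    by_cases hj : j = i
    · subst hj
      simpa using h
    · simpa [hj] using hN j
  simpa using hrefl _ _ hle i

lemma apply_eq_of_coordinate_eq {ι : Type*} {F : (ι → ℝ) → ℝ} {i : ι} (hF : Continuous F)
    (hrefl : ∀ u v, F u ≤ F v → u i ≤ v i) {u v : ι → ℝ} (huv : u i = v i) : F u = F v := by
  have hle : ∀ {u v : ι → ℝ}, u i = v i → F u ≤ F v := fun {u v} huv => by
    have hlim : Filter.Tendsto (fun ε : ℝ => F fun j => v j + ε) (nhdsWithin 0 (Set.Ioi 0))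
        (nhds (F v)) := by
      have hcont : Continuous fun ε : ℝ => F fun j => v j + ε := by fun_prop
      simpa using hcont.continuousAt.tendsto.mono_left (nhdsWithin_le_nhds (a := (0 : ℝ)))
    refine ge_of_tendsto hlim (eventually_mem_nhdsWithin.mono fun ε hε => ?_)
    by_contra! hlt
    have hεv := hrefl _ _ hlt.le
    linarith [Set.mem_Ioi.1 hε]
  exact (hle huv).antisymm (hle huv.symm)

namespace TorusChart

variable {X : Type u} [TopologicalSpace X] {D : DStructure X} {n : ℕ} (c : TorusChart D n)

lemma nonempty_dpath (c : TorusChart D n) (x y : X) : Nonempty (DPath D x y) := by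
  obtain ⟨σ, -⟩ := c.exists_len_eq (L := fun i => Circle.angleDiff (c.coord x i) (c.coord y i))
    (fun i => Circle.angleDiff_nonneg _ _) fun i => mul_exp_angleDiff _ _
  exact ⟨σ.exists_rep.choose⟩

lemma le_of_lift_le_of_isPsp {𝓕 : EquivalenceFamily.{u}} {f : C(X, X)} (hf : IsPsp 𝓕 D f)
    {θ : Fin n → X → ℝ} (hθ : ∀ i, Continuous (θ i))
    (h : ∀ x i, c.coord (f x) i = c.coord x i * Circle.exp (θ i x)) {u v : Fin n → ℝ}
    (huv : ∀ i, u i + θ i (c.point u) ≤ v i + θ i (c.point v)) : u ≤ v := by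
  obtain ⟨σ, hσ⟩ := c.exists_len_eq (x := f (c.point u)) (y := f (c.point v))
    (L := fun i => v i + θ i (c.point v) - (u i + θ i (c.point u))) (fun i => sub_nonneg.2 (huv i))
    fun i => by simp only [h, coord_point, ← Circle.exp_add, add_sub_cancel]
  obtain ⟨τ, rfl⟩ := hf.surjective_map ⟨_, _, c.nonempty_dpath (c.point u) (c.point v)⟩ σ
  intro i
  have hlen := (c.len_map c hf.1 rfl rfl (hθ i) (fun x => h x i) τ).symm.trans (congrFun hσ i)
  linarith [c.len_nonneg τ i]

lemma exists_eq_shiftMap_of_isPsp {𝓕 : EquivalenceFamily.{u}} {f : C(X, X)} (hf : IsPsp 𝓕 D f)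
    {θ : Fin n → X → ℝ} (hθ : ∀ i, Continuous (θ i))
    (h : ∀ x i, c.coord (f x) i = c.coord x i * Circle.exp (θ i x)) :
    ∃ δ : Fin n → AngularShift, f = c.shiftMap δ := by
  let F : (Fin n → ℝ) → Fin n → ℝ := fun u i => u i + θ i (c.point u)
  have htrans : ∀ u (k : Fin n → ℕ), F (u + fun j => k j * (2 * Real.pi)) =
      F u + fun j => k j * (2 * Real.pi) := fun u k => by
    have hpoint : c.point (u + fun j => k j * (2 * Real.pi)) = c.point u := c.coord_ext fun j => by
      rw [coord_point, coord_point, Circle.exp_eq_exp]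
      exact ⟨k j, rfl⟩
    ext j
    simp only [F, hpoint, Pi.add_apply]
    ring
  have hrefl : ∀ i u v, F u i ≤ F v i → u i ≤ v i := fun i u v =>
    le_of_apply_le_of_translation Real.two_pi_pos htrans
      fun _ _ huv => c.le_of_lift_le_of_isPsp hf hθ h huv
  have hF : ∀ i, Continuous fun u => F u i := fun i => by fun_prop
  choose δ hδ using fun i => exists_continuousMap_circle_of_periodic
    (f := fun s => θ i (c.point fun _ => s)) (by fun_prop) fun s => by simp [point]
  refine ⟨fun i => ⟨δ i, fun s t hst => lt_of_not_ge fun hle => ?_⟩, ?_⟩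
  · simp only [hδ] at hle
    exact hst.not_ge (hrefl i (fun _ => t) (fun _ => s) hle)
  · ext x
    obtain ⟨u, rfl⟩ := c.exists_point x
    refine c.coord_ext fun i => ?_
    have hdiag : F u i = F (fun _ => u i) i :=
      apply_eq_of_coordinate_eq (v := fun _ => u i) (hF i) (hrefl i) rfl
    rw [h, coord_shiftMap, coord_point, hδ, add_left_cancel hdiag]

lemma exists_eq_shiftMap_of_homotopic {𝓕 : EquivalenceFamily.{u}} {f : C(X, X)}
    (hid : (ContinuousMap.id X).Homotopic f) (hf : IsPsp 𝓕 D f) :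
    ∃ δ : Fin n → AngularShift, f = c.shiftMap δ := by
  obtain ⟨H⟩ := hid
  choose Θ hΘ hHΘ using fun i => exists_circleExp_homotopyLift
    (K := fun q : unitInterval × X => c.coord (H q) i / c.coord q.2 i) (by fun_prop) (f := 0)
    continuous_const fun x => by simp
  refine c.exists_eq_shiftMap_of_isPsp hf (θ := fun i x => Θ i (1, x)) (fun i => by fun_prop)
    fun x i => ?_
  rw [← hHΘ, mul_div_cancel, H.apply_one]

lemma exists_eq_shiftMap_of_isInessential {𝓕 : EquivalenceFamily.{u}} {α : Flavour} {f : C(X, X)}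
    {p q : RPair D} (hf : IsInessential 𝓕 D α f p q) :
    ∃ δ : Fin n → AngularShift, f = c.shiftMap δ :=
  c.exists_eq_shiftMap_of_homotopic hf.homotopic_id_and_isPsp.1 hf.homotopic_id_and_isPsp.2

end TorusChart

/-! ### Functors on component categories -/

section Arrows

variable {C : Type*} [Category* C] {a b d a' b' d' : C}

lemma arrowMk_eqToHom (h : a = b) : Arrow.mk (eqToHom h) = Arrow.mk (𝟙 a) := by
  subst h
  rfl

lemma arrowMk_comp_congr {f : a ⟶ b} {g : b ⟶ d} {f' : a' ⟶ b'} {g' : b' ⟶ d'}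
    (hf : Arrow.mk f = Arrow.mk f') (hg : Arrow.mk g = Arrow.mk g') :
    Arrow.mk (f ≫ g) = Arrow.mk (f' ≫ g') := by
  obtain ⟨rfl, rfl, hf⟩ := (Arrow.mk_eq_mk_iff _ _).1 hf
  obtain ⟨_, rfl, hg⟩ := (Arrow.mk_eq_mk_iff _ _).1 hg
  simp only [eqToHom_refl, Category.id_comp, Category.comp_id] at hf hg
  rw [hf, hg]

lemma arrowMk_comp_of_right_eq_id {f : a ⟶ b} {g : b ⟶ d} (hg : Arrow.mk g = Arrow.mk (𝟙 d')) :
    Arrow.mk (f ≫ g) = Arrow.mk f := by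
  obtain ⟨rfl, rfl, hg⟩ := (Arrow.mk_eq_mk_iff _ _).1 hg
  simp [hg]

lemma arrowMk_comp_of_left_eq_id {f : a ⟶ b} {g : b ⟶ d} (hf : Arrow.mk f = Arrow.mk (𝟙 d')) :
    Arrow.mk (f ≫ g) = Arrow.mk g := by
  obtain ⟨rfl, rfl, hf⟩ := (Arrow.mk_eq_mk_iff _ _).1 hf
  simp [hf]

lemma arrowMk_map_eq_of_functor_eq {B : Type*} [Category* B] {F G : C ⥤ B} (h : F = G)
    (f : a ⟶ b) : Arrow.mk (F.map f) = Arrow.mk (G.map f) := h ▸ rfl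

lemma pathsFunctor_ext_of_arrowMk {V : Type*} [Quiver V] {F G : Paths V ⥤ C}
    (h_obj : ∀ a, F.obj a = G.obj a)
    (h : ∀ (a b : V) (e : a ⟶ b), Arrow.mk (F.map ((Paths.of V).map e)) =
      Arrow.mk (G.map ((Paths.of V).map e))) : F = G :=
  Paths.ext_functor (funext h_obj) fun a b e => ((Arrow.mk_eq_mk_iff _ _).1 (h a b e)).2.2

end Arrows

section ComponentLift

variable {C : Type u} [Category.{v} C] {W : MorphismProperty C} {B : Type*} [Category* B]

lemma arrowMk_toComponentCategory_map {x y : C} (f : x ⟶ y) (hf : W f) :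
    Arrow.mk ((toComponentCategory W).map f) = Arrow.mk (𝟙 ((toComponentCategory W).obj x)) := by
  have hcollapse : ∀ {b : ComponentVertex W} (hy : componentOf W y = b),
      Arrow.mk ((CategoryTheory.Quotient.functor (ComponentRel W)).map (componentHom W f rfl hy)) =
        Arrow.mk (𝟙 ((toComponentCategory W).obj x)) := fun hy => by
    obtain rfl := (componentOf_eq f hf).trans hy
    exact congrArg Arrow.mk (CategoryTheory.Quotient.sound _ (ComponentRel.collapse f hf))
  exact hcollapse rfl

/-- The functor from the free category on the generators of `C / W` induced by a functor on `C` that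
maps the morphisms of `W` to identities. -/
def componentLiftPaths (F : C ⥤ B)
    (h : ∀ {x y : C} (f : x ⟶ y), W f → Arrow.mk (F.map f) = Arrow.mk (𝟙 (F.obj x))) :
    Paths (ComponentVertex W) ⥤ B :=
  Paths.lift
    { obj := fun a => Quot.lift F.obj
        (fun _ _ ⟨f, hf⟩ => (congrArg Comma.right (h f hf)).symm) a.comp
      map := fun {a b} (g : ComponentGen W a b) =>
        eqToHom (by obtain ⟨x, y, f, rfl, rfl⟩ := g; rfl) ≫ F.map g.hom ≫
        eqToHom (by obtain ⟨x, y, f, rfl, rfl⟩ := g; rfl) }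

lemma arrowMk_componentLiftPaths_map (F : C ⥤ B)
    (h : ∀ {x y : C} (f : x ⟶ y), W f → Arrow.mk (F.map f) = Arrow.mk (𝟙 (F.obj x))) {x y : C}
    (f : x ⟶ y) {a b : ComponentVertex W} (hx : componentOf W x = a) (hy : componentOf W y = b) :
    Arrow.mk ((componentLiftPaths F h).map (componentHom W f hx hy)) = Arrow.mk (F.map f) := by
  subst hx hy
  exact (congrArg Arrow.mk (Paths.lift_toPath _ _)).trans
    ((Arrow.arrow_mk_eqToHom_comp _ _).trans (Arrow.arrow_mk_comp_eqToHom _ _))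

/-- The functor on `C / W` induced by a functor on `C` that maps the morphisms of `W` to
identities. -/
def componentLift (F : C ⥤ B)
    (h : ∀ {x y : C} (f : x ⟶ y), W f → Arrow.mk (F.map f) = Arrow.mk (𝟙 (F.obj x))) :
    ComponentCategory W ⥤ B :=
  CategoryTheory.Quotient.lift _ (componentLiftPaths F h) (by
    rintro _ _ _ _ (x | ⟨f, g⟩ | ⟨f, hf⟩) <;> rw [← Arrow.mk_inj]
    · rw [arrowMk_componentLiftPaths_map, F.map_id, (componentLiftPaths F h).map_id]
      rfl
    · rw [Functor.map_comp, arrowMk_componentLiftPaths_map, F.map_comp]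
      exact arrowMk_comp_congr (arrowMk_componentLiftPaths_map F h f rfl rfl)
        (arrowMk_componentLiftPaths_map F h g rfl rfl)
    · rw [arrowMk_componentLiftPaths_map, h f hf, (componentLiftPaths F h).map_id]
      rfl)

lemma toComponentCategory_comp_componentLift (F : C ⥤ B)
    (h : ∀ {x y : C} (f : x ⟶ y), W f → Arrow.mk (F.map f) = Arrow.mk (𝟙 (F.obj x))) :
    toComponentCategory W ⋙ componentLift F h = F :=
  Arrow.functor_ext fun _ _ f => arrowMk_componentLiftPaths_map F h f rfl rfl

lemma componentCategory_functor_ext {F G : ComponentCategory W ⥤ B}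
    (h : toComponentCategory W ⋙ F = toComponentCategory W ⋙ G) : F = G := by
  refine CategoryTheory.Quotient.lift_unique' _ _ _ (pathsFunctor_ext_of_arrowMk ?_ ?_)
  · rintro ⟨a⟩
    obtain ⟨x, rfl⟩ := Quot.exists_rep a
    exact Functor.congr_obj h x
  · rintro _ _ ⟨x, y, f, rfl, rfl⟩
    exact arrowMk_map_eq_of_functor_eq h f

end ComponentLift

section PairLift

variable {X : Type u} [TopologicalSpace X] {𝓕 : EquivalenceFamily.{u}} {α : Flavour}
  {D : DStructure X}

variable (𝓕 α) in
/-- An inessential map as a morphism of the mixed category. -/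
def mixedMap {p q : RPair D} (f : C(X, X)) (hf : IsInessential 𝓕 D α f p q) :
    (extToMixed 𝓕 α D).obj p ⟶ (extToMixed 𝓕 α D).obj q :=
  (CategoryTheory.Quotient.functor (MixedRel 𝓕 α D)).map (freeMap 𝓕 α f hf)

lemma mixedCategory_functor_ext {B : Type*} [Category* B] {F G : MixedCategory 𝓕 α D ⥤ B}
    (hext : extToMixed 𝓕 α D ⋙ F = extToMixed 𝓕 α D ⋙ G)
    (hmap : ∀ {p q : RPair D} (f : C(X, X)) (hf : IsInessential 𝓕 D α f p q),
      Arrow.mk (F.map (mixedMap 𝓕 α f hf)) = Arrow.mk (G.map (mixedMap 𝓕 α f hf))) : F = G := by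
  refine CategoryTheory.Quotient.lift_unique' _ _ _ (pathsFunctor_ext_of_arrowMk ?_ ?_)
  · rintro ⟨p⟩
    exact Functor.congr_obj hext p
  · rintro ⟨p⟩ ⟨q⟩ (e | ⟨f, hf⟩)
    · exact arrowMk_map_eq_of_functor_eq hext e
    · exact hmap f hf

lemma arrowMk_toComponentCategory_map_mixedMap {p q : RPair D} {f : C(X, X)}
    (hf : IsInessential 𝓕 D α f p q) :
    Arrow.mk ((toComponentCategory (inessentialMorphisms 𝓕 α D)).map (mixedMap 𝓕 α f hf)) =
      Arrow.mk (𝟙 ((pairComponent 𝓕 α D).obj p)) :=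
  arrowMk_toComponentCategory_map _ (inessentialMorphisms.map f hf)

lemma pairComponent_functor_ext {B : Type*} [Category* B] {F G : PairComponentCategory 𝓕 α D ⥤ B}
    (h : pairComponent 𝓕 α D ⋙ F = pairComponent 𝓕 α D ⋙ G) : F = G := by
  refine componentCategory_functor_ext (mixedCategory_functor_ext h fun {p q} f hf => ?_)
  have hmap : ∀ K : PairComponentCategory 𝓕 α D ⥤ B,
      Arrow.mk ((toComponentCategory _ ⋙ K).map (mixedMap 𝓕 α f hf)) =
        Arrow.mk ((pairComponent 𝓕 α D ⋙ K).map (𝟙 p)) := fun K =>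
    (congrArg K.mapArrow.obj (arrowMk_toComponentCategory_map_mixedMap hf)).trans <| by
      rw [CategoryTheory.Functor.map_id]
      exact congrArg Arrow.mk (K.map_id _)
  rw [hmap, hmap, h]

lemma arrowMk_map_mixedMap_comp {p q r : RPair D} {f : C(X, X)} (hf : IsInessential 𝓕 D α f p q)
    (e : q ⟶ r) :
    Arrow.mk ((toComponentCategory (inessentialMorphisms 𝓕 α D)).map
      (mixedMap 𝓕 α f hf ≫ (extToMixed 𝓕 α D).map e)) = Arrow.mk ((pairComponent 𝓕 α D).map e) := by
  rw [Functor.map_comp]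
  exact arrowMk_comp_of_left_eq_id (arrowMk_toComponentCategory_map_mixedMap hf)

lemma arrowMk_map_comp_mixedMap {p q r : RPair D} {f : C(X, X)} (e : p ⟶ q)
    (hf : IsInessential 𝓕 D α f q r) :
    Arrow.mk ((toComponentCategory (inessentialMorphisms 𝓕 α D)).map
      ((extToMixed 𝓕 α D).map e ≫ mixedMap 𝓕 α f hf)) = Arrow.mk ((pairComponent 𝓕 α D).map e) := by
  rw [Functor.map_comp]
  exact arrowMk_comp_of_right_eq_id (arrowMk_toComponentCategory_map_mixedMap hf)

lemma pairComponent_square {p q : RPair D} (f : C(X, X)) (hd : IsDMap D D f)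
    (hp : IsInessential 𝓕 D α f p (p.map f hd)) (hq : IsInessential 𝓕 D α f q (q.map f hd))
    (e : p ⟶ q) : Arrow.mk ((pairComponent 𝓕 α D).map e) =
      Arrow.mk ((pairComponent 𝓕 α D).map ((extMap f hd).map e)) := by
  refine (arrowMk_map_comp_mixedMap e hq).symm.trans
    (Eq.trans ?_ (arrowMk_map_mixedMap_comp hp ((extMap f hd).map e)))
  exact congrArg (fun k => Arrow.mk ((toComponentCategory _).map k))
    (CategoryTheory.Quotient.sound _ (MixedRel.square f hd hp hq e)).symm

lemma pairComponent_flow {p : RPair D} {f g : C(X, X)} {H : C(X × unitInterval, X)}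
    (hH : IsSimpleDHomotopy D H) (h0 : ∀ x, H (x, 0) = f x) (h1 : ∀ x, H (x, 1) = g x)
    (hid : f = ContinuousMap.id X ∨ g = ContinuousMap.id X)
    (hfd : IsDMap D D f) (hgd : IsDMap D D g)
    (hf : IsInessential 𝓕 D α f p (p.map f hfd)) (hg : IsInessential 𝓕 D α g p (p.map g hgd))
    (hr : Nonempty (DPath D (f p.src) (g p.tgt))) :
    Arrow.mk ((pairComponent 𝓕 α D).map (X := p.map f hfd) (Y := ⟨f p.src, g p.tgt, hr⟩)
        (FundHom.refl (f p.src), FundHom.mk (flowPath H hH (h0 p.tgt) (h1 p.tgt)))) =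
      Arrow.mk ((pairComponent 𝓕 α D).map (X := p.map g hgd) (Y := ⟨f p.src, g p.tgt, hr⟩)
        (FundHom.mk (flowPath H hH (h0 p.src) (h1 p.src)), FundHom.refl (g p.tgt))) := by
  rw [← arrowMk_map_mixedMap_comp hf, ← arrowMk_map_mixedMap_comp hg]
  exact congrArg (fun k => Arrow.mk ((toComponentCategory _).map k))
    (CategoryTheory.Quotient.sound _ (MixedRel.flow f g H hH h0 h1 hid hfd hgd hf hg hr))

end PairLift

/-! ### The degree functor -/

namespace BitVec01

variable {n : ℕ}

lemma ext_bit {d d' : BitVec01 n} (h : ∀ i, d.bit i = d'.bit i) : d = d' :=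
  congrArg BitVec01.mk (funext h)

lemma hom_ext {d d' : BitVec01 n} {k l : d ⟶ d'} (h : ∀ i, k.1 i = l.1 i) : k = l :=
  Subtype.ext (funext h)

lemma arrowMk_eq {a b a' b' : BitVec01 n} {k : a ⟶ b} {l : a' ⟶ b'} (ha : a = a') (hb : b = b')
    (h : ∀ i, k.1 i = l.1 i) : Arrow.mk k = Arrow.mk l := by
  subst ha hb
  rw [hom_ext h]

end BitVec01

lemma exists_nat_eq_add_mul_two_pi {a b : ℝ} (ha : a < 2 * Real.pi) (hb : 0 ≤ b)
    (h : Circle.exp b = Circle.exp a) : ∃ k : ℕ, b = a + k * (2 * Real.pi) := by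
  obtain ⟨m, hm⟩ := Circle.exp_eq_exp.1 h
  have hneg : (-1 : ℝ) < m := by
    by_contra! hle
    nlinarith [Real.two_pi_pos]
  lift m to ℕ using by
    have : (-1 : ℤ) < m := by exact_mod_cast hneg
    omega
  exact ⟨m, hm⟩

namespace TorusChart

variable {X : Type u} [TopologicalSpace X] {D : DStructure X} {n : ℕ} (c : TorusChart D n)

/-- The least angle swept by a d-path between the two points of a pair. -/
noncomputable def arc (p : RPair D) (i : Fin n) : ℝ :=
  Circle.angleDiff (c.coord p.src i) (c.coord p.tgt i)

lemma arc_nonneg (p : RPair D) (i : Fin n) : 0 ≤ c.arc p i := Circle.angleDiff_nonneg _ _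

lemma arc_lt (p : RPair D) (i : Fin n) : c.arc p i < 2 * Real.pi := Circle.angleDiff_lt_two_pi _ _

open Classical in
/-- The bit vector that records the coordinates in which the two points of a pair differ. -/
noncomputable def bits (p : RPair D) : BitVec01 n :=
  ⟨fun i => decide (c.coord p.src i ≠ c.coord p.tgt i)⟩

lemma bits_eq_true_iff {p : RPair D} {i : Fin n} :
    (c.bits p).bit i = true ↔ c.coord p.src i ≠ c.coord p.tgt i := by
  simp [bits]

lemma bits_eq_false_iff {p : RPair D} {i : Fin n} :
    (c.bits p).bit i = false ↔ c.coord p.src i = c.coord p.tgt i := by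
  simp [bits]

lemma arc_eq_zero_iff {p : RPair D} {i : Fin n} :
    c.arc p i = 0 ↔ (c.bits p).bit i = false := by
  rw [bits_eq_false_iff]
  refine ⟨fun h => ?_, fun h => by rw [arc, h, angleDiff_self]⟩
  rw [← mul_exp_angleDiff (c.coord p.src i) (c.coord p.tgt i), ← arc, h, Circle.exp_zero, mul_one]

/-- The angle swept by the shortest d-path between the two points of a pair, extended by the two
d-paths of a morphism of pairs. -/
noncomputable def extLen {p q : RPair D} (e : p ⟶ q) (i : Fin n) : ℝ :=
  c.len e.1 i + c.arc p i + c.len e.2 i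

lemma mul_exp_extLen {p q : RPair D} (e : p ⟶ q) (i : Fin n) :
    c.coord q.src i * Circle.exp (c.extLen e i) = c.coord q.tgt i := by
  have harc : c.coord p.src i * Circle.exp (c.arc p i) = c.coord p.tgt i := mul_exp_angleDiff _ _
  rw [extLen, Circle.exp_add, Circle.exp_add, ← mul_assoc, ← mul_assoc, mul_exp_len, harc,
    mul_exp_len]

lemma exists_extLen_eq {p q : RPair D} (e : p ⟶ q) (i : Fin n) :
    ∃ k : ℕ, c.extLen e i = c.arc q i + k * (2 * Real.pi) := by
  refine exists_nat_eq_add_mul_two_pi (c.arc_lt q i) ?_ ?_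
  · exact add_nonneg (add_nonneg (c.len_nonneg _ _) (c.arc_nonneg _ _)) (c.len_nonneg _ _)
  · rw [← mul_right_inj (c.coord q.src i), mul_exp_extLen, arc, mul_exp_angleDiff]

/-- The number of full turns added by a morphism of pairs. -/
noncomputable def degree {p q : RPair D} (e : p ⟶ q) (i : Fin n) : ℕ :=
  (c.exists_extLen_eq e i).choose

lemma extLen_eq {p q : RPair D} (e : p ⟶ q) (i : Fin n) :
    c.extLen e i = c.arc q i + c.degree e i * (2 * Real.pi) :=
  (c.exists_extLen_eq e i).choose_spec

lemma degree_eq {p q : RPair D} {e : p ⟶ q} {i : Fin n} {k : ℕ}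
    (h : c.extLen e i = c.arc q i + k * (2 * Real.pi)) : c.degree e i = k := by
  rw [extLen_eq, add_right_inj, mul_left_inj' Real.two_pi_pos.ne'] at h
  exact_mod_cast h

lemma degree_eq_degree_of_extLen_eq {p p' q : RPair D} {e : p ⟶ q} {e' : p' ⟶ q} {i : Fin n}
    (h : c.extLen e i = c.extLen e' i) : c.degree e i = c.degree e' i :=
  c.degree_eq (h.trans (c.extLen_eq e' i))

lemma degree_pos {p q : RPair D} (e : p ⟶ q) (i : Fin n) (hp : (c.bits p).bit i = true)
    (hq : (c.bits q).bit i = false) : 0 < c.degree e i := by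
  have hpos : 0 < c.extLen e i := add_pos_of_pos_of_nonneg (add_pos_of_nonneg_of_pos
    (c.len_nonneg _ _) (Circle.angleDiff_pos (c.bits_eq_true_iff.1 hp))) (c.len_nonneg _ _)
  rw [extLen_eq, c.arc_eq_zero_iff.2 hq, zero_add] at hpos
  exact_mod_cast pos_of_mul_pos_left hpos Real.two_pi_pos.le

lemma degree_id (p : RPair D) (i : Fin n) : c.degree (𝟙 p) i = 0 := by
  refine c.degree_eq ?_
  have hlen : c.extLen (𝟙 p) i =
      c.len (FundHom.refl p.src) i + c.arc p i + c.len (FundHom.refl p.tgt) i := rfl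
  simp [hlen]

lemma degree_comp {p q r : RPair D} (e : p ⟶ q) (e' : q ⟶ r) (i : Fin n) :
    c.degree (e ≫ e') i = c.degree e i + c.degree e' i := by
  have hlen : c.extLen (e ≫ e') i =
      c.len (e'.1.trans e.1) i + c.arc p i + c.len (e.2.trans e'.2) i := rfl
  have he := c.extLen_eq e i
  have he' := c.extLen_eq e' i
  refine c.degree_eq ?_
  rw [hlen, len_trans, len_trans]
  rw [extLen] at he he'
  push_cast
  linarith

/-- The functor that counts full turns. -/
noncomputable def degreeFunctor : RPair D ⥤ BitVec01 n where
  obj := c.bits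
  map e := ⟨c.degree e, c.degree_pos e⟩
  map_id p := BitVec01.hom_ext (c.degree_id p)
  map_comp e e' := BitVec01.hom_ext (c.degree_comp e e')

/-! ### The degree on the pair component category -/

lemma bits_map_shiftMap (δ : Fin n → AngularShift) (hd : IsDMap D D (c.shiftMap δ))
    (p : RPair D) : c.bits (p.map _ hd) = c.bits p :=
  BitVec01.ext_bit fun i => by
    rw [Bool.eq_iff_iff, bits_eq_true_iff, bits_eq_true_iff, RPair.map, coord_shiftMap,
      coord_shiftMap]
    exact (δ i).toHomeomorph.injective.ne_iff

lemma arc_map_shiftMap (δ : Fin n → AngularShift) (hd : IsDMap D D (c.shiftMap δ)) (p : RPair D)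
    (i : Fin n) : c.arc (p.map _ hd) i =
      c.arc p i + δ i (c.coord p.tgt i) - δ i (c.coord p.src i) := by
  rw [arc, RPair.map, coord_shiftMap, coord_shiftMap, AngularShift.angleDiff_shift, arc]

lemma len_map_shiftMap (δ : Fin n → AngularShift) (hd : IsDMap D D (c.shiftMap δ)) {x y : X}
    (σ : FundHom D x y) (i : Fin n) : c.len (FundHom.map _ hd rfl rfl σ) i =
      c.len σ i + δ i (c.coord y i) - δ i (c.coord x i) :=
  c.len_map c hd rfl rfl (θ := fun x => δ i (c.coord x i)) (by fun_prop)
    (fun x => c.coord_shiftMap δ x i) σ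

lemma degree_map_shiftMap (δ : Fin n → AngularShift) (hd : IsDMap D D (c.shiftMap δ))
    {p q : RPair D} (e : p ⟶ q) (i : Fin n) :
    c.degree ((extMap _ hd).map e) i = c.degree e i := by
  have hlen : c.extLen ((extMap _ hd).map e) i =
      c.len (FundHom.map _ hd rfl rfl e.1) i + c.arc (p.map _ hd) i +
        c.len (FundHom.map _ hd rfl rfl e.2) i := rfl
  have he := c.extLen_eq e i
  refine c.degree_eq ?_
  rw [hlen, len_map_shiftMap, len_map_shiftMap, arc_map_shiftMap]
  change _ = c.arc (q.map _ hd) i + _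
  rw [arc_map_shiftMap]
  rw [extLen] at he
  linarith

lemma bits_eq_of_isInessential {𝓕 : EquivalenceFamily.{u}} {α : Flavour} {f : C(X, X)}
    {p q : RPair D} (hf : IsInessential 𝓕 D α f p q) : c.bits p = c.bits q := by
  obtain ⟨δ, rfl⟩ := c.exists_eq_shiftMap_of_isInessential hf
  have hpq : p.map _ (c.isDMap_shiftMap δ) = q := RPair.ext hf.1 hf.2.1
  rw [← hpq, bits_map_shiftMap]

lemma pathLen_flowPath_sub_eq {H : C(X × unitInterval, X)} (hH : IsSimpleDHomotopy D H)
    {δ ε : Fin n → AngularShift} (h0 : ∀ x, H (x, 0) = c.shiftMap δ x)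
    (h1 : ∀ x, H (x, 1) = c.shiftMap ε x) (x y : X) (i : Fin n) :
    c.pathLen (flowPath H hH (h0 x) (h1 x)) i - (ε i (c.coord x i) - δ i (c.coord x i)) =
      c.pathLen (flowPath H hH (h0 y) (h1 y)) i - (ε i (c.coord y i) - δ i (c.coord y i)) := by
  obtain ⟨Θ, hΘ, hHΘ⟩ := exists_circleExp_homotopyLift
    (K := fun q : unitInterval × X => c.coord (H (q.2, q.1)) i / c.coord q.2 i) (by fun_prop)
    (f := fun x => δ i (c.coord x i)) (by fun_prop) fun x => by
      simp only [h0, coord_shiftMap, mul_div_cancel_left]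
  have hlen : ∀ x, c.pathLen (flowPath H hH (h0 x) (h1 x)) i = Θ (1, x) - Θ (0, x) := fun x => by
    rw [c.pathLen_eq _ i (g := fun t => Complex.arg (c.coord x i) + Θ (t, x)) (by fun_prop)]
    · ring
    · intro t
      rw [Circle.exp_add, Circle.exp_arg, ← hHΘ, mul_div_cancel]
      rfl
  obtain ⟨γ⟩ := c.nonempty_dpath x y
  have hδ := sub_eq_sub_of_circleExp_eq (f := fun t => Θ (0, γ.1 t))
    (g := fun t => δ i (c.coord (γ.1 t) i)) (by fun_prop) (by fun_prop)
    (fun t => by simp only [← hHΘ, h0, coord_shiftMap, mul_div_cancel_left]) 0 1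
  have hε := sub_eq_sub_of_circleExp_eq (f := fun t => Θ (1, γ.1 t))
    (g := fun t => ε i (c.coord (γ.1 t) i)) (by fun_prop) (by fun_prop)
    (fun t => by simp only [← hHΘ, h1, coord_shiftMap, mul_div_cancel_left]) 0 1
  simp only [γ.1.source, γ.1.target] at hδ hε
  rw [hlen, hlen]
  linarith

lemma degree_flow {p : RPair D} {H : C(X × unitInterval, X)} (hH : IsSimpleDHomotopy D H)
    {δ ε : Fin n → AngularShift} (h0 : ∀ x, H (x, 0) = c.shiftMap δ x)
    (h1 : ∀ x, H (x, 1) = c.shiftMap ε x) (hδ : IsDMap D D (c.shiftMap δ))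
    (hε : IsDMap D D (c.shiftMap ε))
    (hr : Nonempty (DPath D (c.shiftMap δ p.src) (c.shiftMap ε p.tgt))) (i : Fin n) :
    c.degree (p := p.map _ hδ) (q := ⟨_, _, hr⟩)
        (FundHom.refl (c.shiftMap δ p.src), FundHom.mk (flowPath H hH (h0 p.tgt) (h1 p.tgt))) i =
      c.degree (p := p.map _ hε) (q := ⟨_, _, hr⟩)
        (FundHom.mk (flowPath H hH (h0 p.src) (h1 p.src)), FundHom.refl (c.shiftMap ε p.tgt)) i :=
  c.degree_eq_degree_of_extLen_eq <| by
    have hflow := c.pathLen_flowPath_sub_eq hH h0 h1 p.src p.tgt i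
    change c.len (FundHom.refl (c.shiftMap δ p.src)) i + c.arc (p.map _ hδ) i +
        c.pathLen (flowPath H hH (h0 p.tgt) (h1 p.tgt)) i =
      c.pathLen (flowPath H hH (h0 p.src) (h1 p.src)) i + c.arc (p.map _ hε) i +
        c.len (FundHom.refl (c.shiftMap ε p.tgt)) i
    rw [len_refl, len_refl, arc_map_shiftMap, arc_map_shiftMap]
    linarith

variable (𝓕 : EquivalenceFamily.{u}) (α : Flavour)

/-- The degree on the free category on extensions and inessential maps; the latter have degree
zero. -/
noncomputable def mixedDegreePaths : Paths (MixedVertex 𝓕 α D) ⥤ BitVec01 n :=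
  Paths.lift
    { obj := fun v => c.bits v.pair
      map := fun {v w} (g : MixedGen 𝓕 α v.pair w.pair) => match g with
        | .ext e => c.degreeFunctor.map e
        | .map _ hf => eqToHom (c.bits_eq_of_isInessential hf) }

lemma mixedDegreePaths_map_freeExt {p q : RPair D} (e : p ⟶ q) :
    (c.mixedDegreePaths 𝓕 α).map (freeExt 𝓕 α e) = c.degreeFunctor.map e :=
  Paths.lift_toPath _ _

variable {𝓕 α}

lemma arrowMk_mixedDegreePaths_map_freeMap {p q : RPair D} {f : C(X, X)}
    (hf : IsInessential 𝓕 D α f p q) :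
    Arrow.mk ((c.mixedDegreePaths 𝓕 α).map (freeMap 𝓕 α f hf)) = Arrow.mk (𝟙 (c.bits p)) :=
  (congrArg Arrow.mk (Paths.lift_toPath _ _)).trans
    (arrowMk_eqToHom (c.bits_eq_of_isInessential hf))

lemma mixedDegreePaths_map_eq {a b : Paths (MixedVertex 𝓕 α D)} {g g' : a ⟶ b}
    (h : MixedRel 𝓕 α D g g') :
    (c.mixedDegreePaths 𝓕 α).map g = (c.mixedDegreePaths 𝓕 α).map g' := by
  have hext := @mixedDegreePaths_map_freeExt _ _ _ _ c 𝓕 α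
  rw [← Arrow.mk_inj]
  cases h with
  | ext_id p =>
    rw [hext, CategoryTheory.Functor.map_id, CategoryTheory.Functor.map_id]
    rfl
  | ext_comp e e' =>
    rw [Functor.map_comp, hext, hext, hext, Functor.map_comp]
    rfl
  | map_id h =>
    rw [arrowMk_mixedDegreePaths_map_freeMap, CategoryTheory.Functor.map_id]
    rfl
  | map_comp f g hf hg hgf =>
    rw [Functor.map_comp, arrowMk_mixedDegreePaths_map_freeMap,
      arrowMk_comp_of_right_eq_id (c.arrowMk_mixedDegreePaths_map_freeMap hg),
      arrowMk_mixedDegreePaths_map_freeMap]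
  | square f hd hp hq e =>
    rw [Functor.map_comp, Functor.map_comp]
    refine (arrowMk_comp_of_left_eq_id (c.arrowMk_mixedDegreePaths_map_freeMap hp)).trans
      (Eq.trans ?_ (arrowMk_comp_of_right_eq_id (c.arrowMk_mixedDegreePaths_map_freeMap hq)).symm)
    obtain ⟨δ, rfl⟩ := c.exists_eq_shiftMap_of_isInessential hp
    rw [hext e]
    exact (congrArg Arrow.mk (hext _)).trans (BitVec01.arrowMk_eq (c.bits_map_shiftMap δ hd _)
      (c.bits_map_shiftMap δ hd _) (c.degree_map_shiftMap δ hd e))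
  | @flow p f g H hH h0 h1 hid hfd hgd hf hg hr =>
    rw [Functor.map_comp, Functor.map_comp,
      arrowMk_comp_of_left_eq_id (c.arrowMk_mixedDegreePaths_map_freeMap hf),
      arrowMk_comp_of_left_eq_id (c.arrowMk_mixedDegreePaths_map_freeMap hg), hext, hext]
    obtain ⟨δ, rfl⟩ := c.exists_eq_shiftMap_of_isInessential hf
    obtain ⟨ε, rfl⟩ := c.exists_eq_shiftMap_of_isInessential hg
    exact BitVec01.arrowMk_eq ((c.bits_map_shiftMap δ hfd p).trans
      (c.bits_map_shiftMap ε hgd p).symm) rfl (c.degree_flow hH h0 h1 hfd hgd hr)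

variable (𝓕 α)

/-- The degree on the mixed category. -/
noncomputable def mixedDegree : MixedCategory 𝓕 α D ⥤ BitVec01 n :=
  CategoryTheory.Quotient.lift _ (c.mixedDegreePaths 𝓕 α) fun _ _ _ _ => c.mixedDegreePaths_map_eq

lemma arrowMk_mixedDegree_map {v w : MixedCategory 𝓕 α D} {f : v ⟶ w}
    (hf : inessentialMorphisms 𝓕 α D f) :
    Arrow.mk ((c.mixedDegree 𝓕 α).map f) = Arrow.mk (𝟙 ((c.mixedDegree 𝓕 α).obj v)) := by
  obtain ⟨f, hf⟩ := hf
  exact c.arrowMk_mixedDegreePaths_map_freeMap hf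

/-- The degree on the pair component category. -/
noncomputable def componentDegree : PairComponentCategory 𝓕 α D ⥤ BitVec01 n :=
  componentLift (c.mixedDegree 𝓕 α) fun _ => c.arrowMk_mixedDegree_map 𝓕 α

lemma pairComponent_comp_componentDegree :
    pairComponent 𝓕 α D ⋙ c.componentDegree 𝓕 α = c.degreeFunctor := by
  refine (congrArg (extToMixed 𝓕 α D ⋙ ·)
    (toComponentCategory_comp_componentLift (c.mixedDegree 𝓕 α)
    fun _ => c.arrowMk_mixedDegree_map 𝓕 α)).trans ?_
  exact Arrow.functor_ext fun _ _ e => congrArg Arrow.mk (c.mixedDegreePaths_map_freeExt 𝓕 α e)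

end TorusChart

/-! ### Shifts with prescribed values -/

namespace AngularShift

lemma exists_apply_exp_eq_sub {h : ℝ → ℝ} (hc : ContinuousOn h (Set.Icc 0 (2 * Real.pi)))
    (hm : StrictMonoOn h (Set.Icc 0 (2 * Real.pi))) (hend : h (2 * Real.pi) = h 0 + 2 * Real.pi) :
    ∃ δ : AngularShift, ∀ s ∈ Set.Icc 0 (2 * Real.pi), δ (Circle.exp s) = h s - s := by
  have hπ := Real.two_pi_pos
  have : Fact (0 < 2 * Real.pi) := ⟨hπ⟩
  let θ : C(Circle, ℝ) := ⟨AddCircle.liftIco (2 * Real.pi) 0 (fun s => h s - s) ∘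
    AddCircle.homeomorphCircle'.symm, (AddCircle.liftIco_zero_continuous (by simp [hend])
      (hc.sub continuousOn_id)).comp AddCircle.homeomorphCircle'.symm.continuous⟩
  have hIco : ∀ s ∈ Set.Ico 0 (2 * Real.pi), θ (Circle.exp s) = h s - s := fun s hs => by
    have hexp : AddCircle.homeomorphCircle'.symm (Circle.exp s) = (s : AddCircle (2 * Real.pi)) :=
      AddCircle.homeomorphCircle'.symm_apply_apply s
    simpa only [θ, ContinuousMap.coe_mk, Function.comp_apply, hexp] using
      AddCircle.liftIco_zero_coe_apply hs
  have hθ : ∀ s ∈ Set.Icc 0 (2 * Real.pi), θ (Circle.exp s) = h s - s := fun s hs => by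
    rcases hs.2.eq_or_lt with rfl | hlt
    · rw [Circle.exp_two_pi, ← Circle.exp_zero, hIco 0 ⟨le_rfl, hπ⟩, hend]
      ring
    · exact hIco s ⟨hs.1, hlt⟩
  let F : AddConstMap ℝ ℝ (2 * Real.pi) (2 * Real.pi) :=
    ⟨fun s => s + θ (Circle.exp s), fun s => by rw [Circle.exp_add_two_pi]; ring⟩
  have hF : StrictMono F := (AddConstMapClass.strictMono_iff_Icc hπ 0).2 <| by
    rw [zero_add]
    refine hm.congr fun s hs => ?_
    change h s = s + θ (Circle.exp s)
    rw [hθ s hs]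
    ring
  exact ⟨⟨θ, hF⟩, hθ⟩

/-- The witness is a tent function on `[0, 2π]`. -/
lemma exists_nonneg_apply_exp_eq {a b : ℝ} (h0 : 0 < a) (hab : a ≤ b) (hb : b < 2 * Real.pi) :
    ∃ δ : AngularShift, (∀ z, 0 ≤ δ z) ∧ δ 1 = 0 ∧ δ (Circle.exp a) = b - a := by
  let κ := (b - a) / a
  let μ := (b - a) / (2 * Real.pi - a)
  have ha : 0 < 2 * Real.pi - a := by linarith
  have hκ : 0 ≤ κ := div_nonneg (sub_nonneg.2 hab) h0.le
  have hμ : 0 ≤ μ := div_nonneg (sub_nonneg.2 hab) ha.le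
  have hμ1 : μ < 1 := (div_lt_one ha).2 (by linarith)
  have hκa : κ * a = b - a := div_mul_cancel₀ _ h0.ne'
  have hμa : μ * (2 * Real.pi - a) = b - a := div_mul_cancel₀ _ ha.ne'
  let tent : ℝ → ℝ := fun s => min (κ * s) (μ * (2 * Real.pi - s))
  have htent0 : tent 0 = 0 := by simp [tent, mul_nonneg hμ Real.two_pi_pos.le]
  have htentπ : tent (2 * Real.pi) = 0 := by simp [tent, mul_nonneg hκ Real.two_pi_pos.le]
  have hmono : StrictMono fun s => s + tent s := fun s t hst => by
    simp only [tent, ← min_add_add_left]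
    exact min_lt_min (by nlinarith) (by nlinarith)
  obtain ⟨δ, hδ⟩ := exists_apply_exp_eq_sub (h := fun s => s + tent s) (by fun_prop)
    (hmono.strictMonoOn _) (by simp [htent0, htentπ])
  simp only [add_sub_cancel_left] at hδ
  refine ⟨δ, fun z => ?_, ?_, ?_⟩
  · have hz := mul_exp_angleDiff 1 z
    have hmem : Circle.angleDiff 1 z ∈ Set.Icc 0 (2 * Real.pi) :=
      ⟨Circle.angleDiff_nonneg _ _, (Circle.angleDiff_lt_two_pi _ _).le⟩
    rw [← hz, one_mul, hδ _ hmem]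
    exact le_min (mul_nonneg hκ hmem.1) (mul_nonneg hμ (sub_nonneg.2 hmem.2))
  · rw [← Circle.exp_zero, hδ 0 ⟨le_rfl, Real.two_pi_pos.le⟩, htent0]
  · rw [hδ a ⟨h0.le, by linarith⟩]
    simp only [tent, hκa, hμa, min_self]

end AngularShift

/-! ### Normal forms of extensions -/

namespace TorusChart

variable {X : Type u} [TopologicalSpace X] {D : DStructure X} {n : ℕ} (c : TorusChart D n)

lemma eq_of_len_eq_zero {x y : X} {σ : FundHom D x y} (h : ∀ i, c.len σ i = 0) : x = y :=
  c.coord_ext fun i => by rw [← c.mul_exp_len σ i, h, Circle.exp_zero, mul_one]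

lemma arrowMk_eq_of_len_eq {p q p' q' : RPair D} (hp : p = p') (hq : q = q') {e : p ⟶ q}
    {e' : p' ⟶ q'} (h1 : ∀ i, c.len e.1 i = c.len e'.1 i) (h2 : ∀ i, c.len e.2 i = c.len e'.2 i) :
    Arrow.mk e = Arrow.mk e' := by
  subst hp hq
  exact congrArg Arrow.mk (Prod.ext (c.hom_ext h1) (c.hom_ext h2))

lemma exists_hom_len_eq {p q : RPair D} {L M : Fin n → ℝ} (hL : 0 ≤ L) (hM : 0 ≤ M)
    (hsrc : ∀ i, c.coord q.src i * Circle.exp (L i) = c.coord p.src i)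
    (htgt : ∀ i, c.coord p.tgt i * Circle.exp (M i) = c.coord q.tgt i) :
    ∃ e : p ⟶ q, (∀ i, c.len e.1 i = L i) ∧ ∀ i, c.len e.2 i = M i := by
  obtain ⟨σ, rfl⟩ := c.exists_len_eq hL hsrc
  obtain ⟨τ, rfl⟩ := c.exists_len_eq hM htgt
  exact ⟨(σ, τ), fun _ => rfl, fun _ => rfl⟩

lemma len_id_fst (p : RPair D) (i : Fin n) : c.len (𝟙 p : p ⟶ p).1 i = 0 := c.len_refl _ i

lemma len_id_snd (p : RPair D) (i : Fin n) : c.len (𝟙 p : p ⟶ p).2 i = 0 := c.len_refl _ i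

lemma len_comp_fst {p q r : RPair D} (e : p ⟶ q) (e' : q ⟶ r) (i : Fin n) :
    c.len (e ≫ e').1 i = c.len e'.1 i + c.len e.1 i := c.len_trans _ _ i

lemma len_comp_snd {p q r : RPair D} (e : p ⟶ q) (e' : q ⟶ r) (i : Fin n) :
    c.len (e ≫ e').2 i = c.len e.2 i + c.len e'.2 i := c.len_trans _ _ i

lemma pathLen_flowPath_shiftHomotopy {δ : Fin n → AngularShift}
    (hH : IsSimpleDHomotopy D (c.shiftHomotopy (fun _ => .const 0) δ)) {x y z : X}
    (hy : c.shiftHomotopy (fun _ => .const 0) δ (x, 0) = y)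
    (hz : c.shiftHomotopy (fun _ => .const 0) δ (x, 1) = z) (i : Fin n) :
    c.pathLen (flowPath _ hH hy hz) i = δ i (c.coord x i) := by
  rw [c.pathLen_eq _ i (g := fun t => Complex.arg (c.coord x i) + t * δ i (c.coord x i))
    (by fun_prop)]
  · simp
  · intro t
    rw [Circle.exp_add, Circle.exp_arg]
    refine (c.coord_shiftHomotopy _ _ (x, t) i).trans ?_
    simp

variable (𝓕 : EquivalenceFamily.{u}) (α : Flavour)

lemma arrowMk_map_shift (δ : Fin n → AngularShift) {p q : RPair D} (e : p ⟶ q) :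
    Arrow.mk ((pairComponent 𝓕 α D).map e) =
      Arrow.mk ((pairComponent 𝓕 α D).map ((extMap _ (c.isDMap_shiftMap δ)).map e)) :=
  pairComponent_square _ _ (c.isInessential_shiftMap 𝓕 α δ rfl rfl)
    (c.isInessential_shiftMap 𝓕 α δ rfl rfl) e

lemma arrowMk_map_flow {δ : Fin n → AngularShift} (hδ : ∀ i z, 0 ≤ δ i z) {p p' q : RPair D}
    (hs : c.shiftMap δ p.src = p'.src) (ht : c.shiftMap δ p.tgt = p'.tgt) {e : p ⟶ q} {e' : p' ⟶ q}
    (he1 : ∀ i, c.len e.1 i = 0) (he2 : ∀ i, c.len e.2 i = δ i (c.coord p.tgt i))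
    (he1' : ∀ i, c.len e'.1 i = δ i (c.coord p.src i)) (he2' : ∀ i, c.len e'.2 i = 0) :
    Arrow.mk ((pairComponent 𝓕 α D).map e) = Arrow.mk ((pairComponent 𝓕 α D).map e') := by
  have h0 : ∀ x, c.shiftMap (fun _ => .const 0) x = x := DFunLike.congr_fun c.shiftMap_const_zero
  have hH := c.isSimpleDHomotopy_shiftHomotopy (δ := fun _ => .const 0) hδ
  have hflow := pairComponent_flow (p := p) hH
    (DFunLike.congr_fun (c.level_shiftHomotopy_zero _ δ))
    (DFunLike.congr_fun (c.level_shiftHomotopy_one _ δ)) (.inl c.shiftMap_const_zero)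
    (c.isDMap_shiftMap _) (c.isDMap_shiftMap δ) (c.isInessential_shiftMap 𝓕 α _ rfl rfl)
    (c.isInessential_shiftMap 𝓕 α _ rfl rfl) (c.nonempty_dpath _ _)
  have hq : q = ⟨c.shiftMap (fun _ => .const 0) p.src, c.shiftMap δ p.tgt,
      c.nonempty_dpath _ _⟩ := RPair.ext ((c.eq_of_len_eq_zero he1).trans (h0 _).symm)
    ((c.eq_of_len_eq_zero he2').symm.trans ht.symm)
  have hp : p = p.map _ (c.isDMap_shiftMap fun _ => .const 0) :=
    RPair.ext (h0 _).symm (h0 _).symm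
  have hp' : p' = p.map _ (c.isDMap_shiftMap δ) := RPair.ext hs.symm ht.symm
  refine (congrArg (pairComponent 𝓕 α D).mapArrow.obj (c.arrowMk_eq_of_len_eq hp hq ?_ ?_)).trans
    (hflow.trans (congrArg (pairComponent 𝓕 α D).mapArrow.obj
      (c.arrowMk_eq_of_len_eq hp' hq ?_ ?_).symm))
  · exact fun i => (he1 i).trans (c.len_refl _ i).symm
  · exact fun i => (he2 i).trans (c.pathLen_flowPath_shiftHomotopy hH _ _ i).symm
  · exact fun i => (he1' i).trans (c.pathLen_flowPath_shiftHomotopy hH _ _ i).symm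
  · exact fun i => (he2' i).trans (c.len_refl _ i).symm

lemma exists_len_fst_eq_zero {p q : RPair D} (e : p ⟶ q) :
    ∃ (p' : RPair D) (e' : p' ⟶ q), (∀ i, c.len e'.1 i = 0) ∧
      Arrow.mk ((pairComponent 𝓕 α D).map e) = Arrow.mk ((pairComponent 𝓕 α D).map e') := by
  let a := c.len e.1
  have ha : 0 ≤ a := c.len_nonneg e.1
  let ρ : Fin n → AngularShift := fun i => .const (-a i)
  let rotate := extMap _ (c.isDMap_shiftMap ρ)
  let m : RPair D := ⟨p.src, q.tgt, c.nonempty_dpath _ _⟩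
  let e₁ : p ⟶ m := (FundHom.refl p.src, e.2)
  let e₂ : m ⟶ q := (e.1, FundHom.refl q.tgt)
  have he : e = e₁ ≫ e₂ := Prod.ext e.1.trans_refl.symm e.2.trans_refl.symm
  have hsrc : ∀ i, c.coord (rotate.obj m).src i = c.coord q.src i := fun i =>
    (c.coord_shiftMap ρ p.src i).trans <| by
      rw [← c.mul_exp_len e.1 i]
      simp [ρ, a, mul_assoc]
  have htgt : ∀ i, c.coord (rotate.obj m).tgt i * Circle.exp (a i) = c.coord q.tgt i := fun i => by
    have hm : c.coord (rotate.obj m).tgt i = c.coord q.tgt i * Circle.exp (-a i) :=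
      c.coord_shiftMap ρ q.tgt i
    simp [hm, mul_assoc]
  obtain ⟨e₃, h₃, h₃'⟩ := c.exists_hom_len_eq (p := rotate.obj m) (q := q) le_rfl ha
    (fun i => by simp [hsrc]) htgt
  have hflow := c.arrowMk_map_flow 𝓕 α (δ := fun i => .const (a i)) (fun i _ => ha i)
    (e := e₃) (e' := e₂)
    (c.coord_ext fun i => by simp [hsrc, a, m, mul_exp_len])
    (c.coord_ext fun i => by simp [htgt, m])
    h₃ h₃' (fun _ => rfl) (c.len_refl _)
  refine ⟨_, rotate.map e₁ ≫ e₃, fun i => ?_, ?_⟩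
  · rw [len_comp_fst, h₃]
    refine (zero_add _).trans ((c.len_map_shiftMap ρ _ (FundHom.refl p.src) i).trans ?_)
    simp [ρ]
  · rw [he, Functor.map_comp, Functor.map_comp]
    exact arrowMk_comp_congr (c.arrowMk_map_shift 𝓕 α ρ e₁) hflow.symm

/-- The pair with source at angle zero and target at the given angles. -/
noncomputable def basedPair (u : Fin n → ℝ) : RPair D :=
  ⟨c.point 0, c.point u, c.nonempty_dpath _ _⟩

lemma coord_basedPair_src (u : Fin n → ℝ) (i : Fin n) : c.coord (c.basedPair u).src i = 1 :=
  (c.coord_point 0 i).trans Circle.exp_zero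

lemma coord_basedPair_tgt (u : Fin n → ℝ) (i : Fin n) :
    c.coord (c.basedPair u).tgt i = Circle.exp (u i) := c.coord_point u i

lemma arc_basedPair {u : Fin n → ℝ} {i : Fin n} (h0 : 0 ≤ u i) (hu : u i < 2 * Real.pi) :
    c.arc (c.basedPair u) i = u i :=
  angleDiff_eq_of_eq_mul_exp h0 hu (by rw [coord_basedPair_src, coord_basedPair_tgt, one_mul])

lemma exists_hom_basedPair {u v : Fin n → ℝ} {k : Fin n → ℕ}
    (h : ∀ i, u i ≤ v i + k i * (2 * Real.pi)) :
    ∃ e : c.basedPair u ⟶ c.basedPair v, (∀ i, c.len e.1 i = 0) ∧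
      ∀ i, c.len e.2 i = v i + k i * (2 * Real.pi) - u i := by
  refine c.exists_hom_len_eq (L := 0) le_rfl (fun i => sub_nonneg.2 (h i)) (fun i => ?_) fun i => ?_
  · simp [coord_basedPair_src]
  · rw [coord_basedPair_tgt, coord_basedPair_tgt, ← Circle.exp_add, add_sub_cancel,
      Circle.exp_eq_exp]
    exact ⟨k i, by simp⟩

lemma exists_hom_basedPair_of_len_fst_eq_zero {p q : RPair D} {e : p ⟶ q}
    (he : ∀ i, c.len e.1 i = 0) :
    ∃ e' : c.basedPair (c.arc p) ⟶ c.basedPair (c.arc q), (∀ i, c.len e'.1 i = 0) ∧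
      Arrow.mk ((pairComponent 𝓕 α D).map e) = Arrow.mk ((pairComponent 𝓕 α D).map e') := by
  let ρ : Fin n → AngularShift := fun i => .const (-Complex.arg (c.coord q.src i))
  let rotate := extMap _ (c.isDMap_shiftMap ρ)
  have hρ : ∀ x i, c.coord (c.shiftMap ρ x) i = c.coord x i * (c.coord q.src i)⁻¹ := fun x i => by
    simp [ρ, Circle.exp_neg, Circle.exp_arg]
  have hobj : ∀ r : RPair D, r.src = q.src → c.basedPair (c.arc r) = rotate.obj r := fun r hr => by
    refine RPair.ext (c.coord_ext fun i => ?_) (c.coord_ext fun i => ?_)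
    · refine (c.coord_basedPair_src _ i).trans (Eq.trans ?_ (hρ r.src i).symm)
      rw [hr, mul_inv_cancel]
    · refine (c.coord_basedPair_tgt _ i).trans (Eq.trans ?_ (hρ r.tgt i).symm)
      rw [← mul_exp_angleDiff (c.coord r.src i) (c.coord r.tgt i), hr, mul_comm,
        inv_mul_cancel_left, arc, hr]
  have hlen : ∀ i, c.len (rotate.map e).1 i = 0 := fun i =>
    (c.len_map_shiftMap ρ _ e.1 i).trans (by simp [he, ρ])
  rw [c.arrowMk_map_shift 𝓕 α ρ e]
  change ∃ e' : _ ⟶ _, _ ∧ Arrow.mk ((pairComponent 𝓕 α D).map (rotate.map e)) = _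
  generalize rotate.map e = e' at hlen ⊢
  revert e'
  rw [← hobj p (c.eq_of_len_eq_zero he).symm, ← hobj q rfl]
  exact fun e' he' => ⟨e', he', rfl⟩

lemma exists_basedPair_map_eq_id {u v : Fin n → ℝ} (h0 : 0 ≤ u) (huv : u ≤ v)
    (hv : ∀ i, v i < 2 * Real.pi) (huv0 : ∀ i, u i = 0 → v i = 0) :
    ∃ e : c.basedPair u ⟶ c.basedPair v, (∀ i, c.len e.1 i = 0) ∧
      ∃ z, Arrow.mk ((pairComponent 𝓕 α D).map e) = Arrow.mk (𝟙 z) := by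
  have hshift : ∀ i, ∃ δ : AngularShift, (∀ z, 0 ≤ δ z) ∧ δ 1 = 0 ∧
      δ (Circle.exp (u i)) = v i - u i := fun i => by
    rcases (h0 i).eq_or_lt with hu | hu
    · exact ⟨.const 0, fun _ => le_rfl, rfl, by simp [huv0 i hu.symm, ← hu]⟩
    · exact AngularShift.exists_nonneg_apply_exp_eq hu (huv i) (hv i)
  choose δ hδ hδ1 hδu using hshift
  obtain ⟨e, he1, he2⟩ := c.exists_hom_basedPair (u := u) (v := v) (k := 0)
    fun i => by simpa using huv i
  simp only [Pi.zero_apply, Nat.cast_zero, zero_mul, add_zero] at he2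
  refine ⟨e, he1, _, (c.arrowMk_map_flow 𝓕 α hδ (p := c.basedPair u) (e' := 𝟙 (c.basedPair v))
    (c.coord_ext fun i => ?_) (c.coord_ext fun i => ?_) he1 (fun i => ?_) (fun i => ?_)
    (c.len_id_snd _)).trans (congrArg Arrow.mk ((pairComponent 𝓕 α D).map_id _))⟩
  · rw [coord_shiftMap, coord_basedPair_src, coord_basedPair_src, hδ1, Circle.exp_zero, one_mul]
  · rw [coord_shiftMap, coord_basedPair_tgt, coord_basedPair_tgt, hδu, ← Circle.exp_add,
      add_sub_cancel]
  · rw [he2, coord_basedPair_tgt, hδu]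
  · rw [len_id_fst, coord_basedPair_src, hδ1]

lemma bits_basedPair_eq_false_iff {u : Fin n → ℝ} {i : Fin n} (hu : u i ∈ Set.Ico 0 (2 * Real.pi)) :
    (c.bits (c.basedPair u)).bit i = false ↔ u i = 0 := by
  rw [← arc_eq_zero_iff, c.arc_basedPair hu.1 hu.2]

lemma len_snd_basedPair {u v : Fin n → ℝ} {i : Fin n} (hu : u i ∈ Set.Ico 0 (2 * Real.pi))
    (hv : v i ∈ Set.Ico 0 (2 * Real.pi)) {e : c.basedPair u ⟶ c.basedPair v}
    (he : c.len e.1 i = 0) : c.len e.2 i = v i + c.degree e i * (2 * Real.pi) - u i := by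
  have hext := c.extLen_eq e i
  rw [extLen, he, c.arc_basedPair hu.1 hu.2, c.arc_basedPair hv.1 hv.2] at hext
  linarith

lemma arrowMk_degree_eq_of_arrowMk_eq {p q p' q' : RPair D} {e : p ⟶ q} {e' : p' ⟶ q'}
    (h : Arrow.mk ((pairComponent 𝓕 α D).map e) = Arrow.mk ((pairComponent 𝓕 α D).map e')) :
    Arrow.mk (c.degreeFunctor.map e) = Arrow.mk (c.degreeFunctor.map e') := by
  rw [← c.pairComponent_comp_componentDegree 𝓕 α]
  exact congrArg (c.componentDegree 𝓕 α).mapArrow.obj h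

lemma exists_arrowMk_eq_of_le {u v u₀ v₁ : Fin n → ℝ} (hu₀ : 0 ≤ u₀) (hv : 0 ≤ v) (huu₀ : u₀ ≤ u)
    (hvv₁ : v ≤ v₁) (hu : ∀ i, u i < 2 * Real.pi) (hv₁ : ∀ i, v₁ i < 2 * Real.pi)
    (hu_zero : ∀ i, u₀ i = 0 → u i = 0) (hv_zero : ∀ i, v i = 0 → v₁ i = 0)
    {e : c.basedPair u ⟶ c.basedPair v} (he : ∀ i, c.len e.1 i = 0) :
    ∃ b : c.basedPair u₀ ⟶ c.basedPair v₁, (∀ i, c.len b.1 i = 0) ∧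
      Arrow.mk ((pairComponent 𝓕 α D).map e) = Arrow.mk ((pairComponent 𝓕 α D).map b) := by
  obtain ⟨f, hf, _, hf_id⟩ := c.exists_basedPair_map_eq_id 𝓕 α hu₀ huu₀ hu hu_zero
  obtain ⟨g, hg, _, hg_id⟩ := c.exists_basedPair_map_eq_id 𝓕 α hv hvv₁ hv₁ hv_zero
  refine ⟨f ≫ e ≫ g, fun i => by simp only [len_comp_fst, hf, he, hg, add_zero], ?_⟩
  rw [Functor.map_comp, Functor.map_comp, arrowMk_comp_of_left_eq_id hf_id,
    arrowMk_comp_of_right_eq_id hg_id]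

lemma arrowMk_eq_of_arrowMk_degree_eq_of_basedPair {u v u' v' : Fin n → ℝ}
    (hu : ∀ i, u i ∈ Set.Ico 0 (2 * Real.pi)) (hv : ∀ i, v i ∈ Set.Ico 0 (2 * Real.pi))
    (hu' : ∀ i, u' i ∈ Set.Ico 0 (2 * Real.pi)) (hv' : ∀ i, v' i ∈ Set.Ico 0 (2 * Real.pi))
    {e : c.basedPair u ⟶ c.basedPair v} {e' : c.basedPair u' ⟶ c.basedPair v'}
    (he : ∀ i, c.len e.1 i = 0) (he' : ∀ i, c.len e'.1 i = 0)
    (h : Arrow.mk (c.degreeFunctor.map e) = Arrow.mk (c.degreeFunctor.map e')) :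
    Arrow.mk ((pairComponent 𝓕 α D).map e) = Arrow.mk ((pairComponent 𝓕 α D).map e') := by
  have hu_zero : ∀ i, u i = 0 ↔ u' i = 0 := fun i => by
    rw [← c.bits_basedPair_eq_false_iff (hu i), ← c.bits_basedPair_eq_false_iff (hu' i)]
    exact Eq.congr_left (congrArg (fun a => BitVec01.bit a.left i) h)
  have hv_zero : ∀ i, v i = 0 ↔ v' i = 0 := fun i => by
    rw [← c.bits_basedPair_eq_false_iff (hv i), ← c.bits_basedPair_eq_false_iff (hv' i)]
    exact Eq.congr_left (congrArg (fun a => BitVec01.bit a.right i) h)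
  have hmin : ∀ i, min (u i) (u' i) = 0 → u i = 0 ∧ u' i = 0 := fun i hi => by
    rcases min_choice (u i) (u' i) with hm | hm <;> rw [hm] at hi
    · exact ⟨hi, (hu_zero i).1 hi⟩
    · exact ⟨(hu_zero i).2 hi, hi⟩
  have hmin_mem : ∀ i, (u ⊓ u') i ∈ Set.Ico 0 (2 * Real.pi) := fun i =>
    ⟨le_min (hu i).1 (hu' i).1, min_lt_of_left_lt (hu i).2⟩
  have hmax_mem : ∀ i, (v ⊔ v') i ∈ Set.Ico 0 (2 * Real.pi) := fun i =>
    ⟨le_max_of_le_left (hv i).1, max_lt (hv i).2 (hv' i).2⟩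
  -- Both extensions move to the common pairs at the minimal and at the maximal angles.
  obtain ⟨b, hb, heb⟩ := c.exists_arrowMk_eq_of_le 𝓕 α (fun i => (hmin_mem i).1)
    (fun i => (hv i).1) inf_le_left le_sup_left (fun i => (hu i).2) (fun i => (hmax_mem i).2)
    (fun i hi => (hmin i hi).1) (fun i hi => by simp [hi, (hv_zero i).1 hi]) he
  obtain ⟨b', hb', heb'⟩ := c.exists_arrowMk_eq_of_le 𝓕 α (fun i => (hmin_mem i).1)
    (fun i => (hv' i).1) inf_le_right le_sup_right (fun i => (hu' i).2) (fun i => (hmax_mem i).2)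
    (fun i hi => (hmin i hi).2) (fun i hi => by simp [hi, (hv_zero i).2 hi]) he'
  have hdeg : Arrow.mk (c.degreeFunctor.map b) = Arrow.mk (c.degreeFunctor.map b') := by
    rw [← c.arrowMk_degree_eq_of_arrowMk_eq 𝓕 α heb, h, c.arrowMk_degree_eq_of_arrowMk_eq 𝓕 α heb']
  have hdeg_apply : ∀ i, c.degree b i = c.degree b' i :=
    congrFun (congrArg (fun a => a.hom.1) hdeg)
  have hbb' : b = b' := Prod.ext (c.hom_ext fun i => (hb i).trans (hb' i).symm) <|
    c.hom_ext fun i => by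
      rw [c.len_snd_basedPair (hmin_mem i) (hmax_mem i) (hb i),
        c.len_snd_basedPair (hmin_mem i) (hmax_mem i) (hb' i), hdeg_apply]
  rw [heb, heb', hbb']

theorem arrowMk_pairComponent_map_eq_iff {p q p' q' : RPair D} {e : p ⟶ q} {e' : p' ⟶ q'} :
    Arrow.mk ((pairComponent 𝓕 α D).map e) = Arrow.mk ((pairComponent 𝓕 α D).map e') ↔
      Arrow.mk (c.degreeFunctor.map e) = Arrow.mk (c.degreeFunctor.map e') := by
  refine ⟨c.arrowMk_degree_eq_of_arrowMk_eq 𝓕 α, fun h => ?_⟩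
  have hbased : ∀ {p q : RPair D} (e : p ⟶ q), ∃ (u v : Fin n → ℝ)
      (b : c.basedPair u ⟶ c.basedPair v), (∀ i, u i ∈ Set.Ico 0 (2 * Real.pi)) ∧
        (∀ i, v i ∈ Set.Ico 0 (2 * Real.pi)) ∧ (∀ i, c.len b.1 i = 0) ∧
        Arrow.mk ((pairComponent 𝓕 α D).map e) = Arrow.mk ((pairComponent 𝓕 α D).map b) :=
    fun {p q} e => by
      obtain ⟨r, f, hf, hef⟩ := c.exists_len_fst_eq_zero 𝓕 α e
      obtain ⟨b, hb, hfb⟩ := c.exists_hom_basedPair_of_len_fst_eq_zero 𝓕 α hf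
      exact ⟨_, _, b, fun i => ⟨c.arc_nonneg r i, c.arc_lt r i⟩,
        fun i => ⟨c.arc_nonneg q i, c.arc_lt q i⟩, hb, hef.trans hfb⟩
  obtain ⟨u, v, b, hu, hv, hb, heb⟩ := hbased e
  obtain ⟨u', v', b', hu', hv', hb', heb'⟩ := hbased e'
  rw [heb, heb']
  refine c.arrowMk_eq_of_arrowMk_degree_eq_of_basedPair 𝓕 α hu hv hu' hv' hb hb' ?_
  rw [← c.arrowMk_degree_eq_of_arrowMk_eq 𝓕 α heb, h, c.arrowMk_degree_eq_of_arrowMk_eq 𝓕 α heb']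

/-- The angles of the standard pair of a bit vector: antipodal points where the bit is set. -/
noncomputable def bitAngle (d : BitVec01 n) (i : Fin n) : ℝ := if d.bit i then Real.pi else 0

lemma bitAngle_mem_Ico (d : BitVec01 n) (i : Fin n) : bitAngle d i ∈ Set.Ico 0 (2 * Real.pi) := by
  unfold bitAngle
  split_ifs <;> constructor <;> linarith [Real.pi_pos]

lemma bits_basedPair_bitAngle (d : BitVec01 n) : c.bits (c.basedPair (bitAngle d)) = d :=
  BitVec01.ext_bit fun i => by
    have hi := c.bits_basedPair_eq_false_iff (bitAngle_mem_Ico d i)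
    cases hd : d.bit i <;> simpa [bitAngle, hd, Real.pi_ne_zero] using hi

lemma bitAngle_le {d d' : BitVec01 n} (k : d ⟶ d') (i : Fin n) :
    bitAngle d i ≤ bitAngle d' i + k.1 i * (2 * Real.pi) := by
  have hd := (bitAngle_mem_Ico d i).2
  have hd' := (bitAngle_mem_Ico d' i).1
  rcases Nat.eq_zero_or_pos (k.1 i) with hk | hk
  · have hbit : d.bit i = true → d'.bit i = true := fun h => by
      by_contra h'
      exact (k.2 i h (by simpa using h')).ne' hk
    rw [hk]
    unfold bitAngle
    cases h : d.bit i <;> cases h' : d'.bit i <;> simp_all [Real.pi_pos.le]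
  · have hk1 : (1 : ℝ) ≤ k.1 i := by exact_mod_cast hk
    nlinarith [Real.two_pi_pos]

/-- The standard pairs and the extensions that fix their source, as a functor. -/
noncomputable def sectionFunctor : BitVec01 n ⥤ RPair D where
  obj d := c.basedPair (bitAngle d)
  map k := (c.exists_hom_basedPair (bitAngle_le k)).choose
  map_id d := by
    obtain ⟨h1, h2⟩ := (c.exists_hom_basedPair (bitAngle_le (𝟙 d))).choose_spec
    refine (Arrow.mk_inj _ _).1 (c.arrowMk_eq_of_len_eq rfl rfl (fun i => ?_) fun i => ?_)
    · rw [h1, len_id_fst]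
    · rw [h2, len_id_snd]
      change _ + ((0 : ℕ) : ℝ) * _ - _ = _
      simp
  map_comp k l := by
    obtain ⟨hk1, hk2⟩ := (c.exists_hom_basedPair (bitAngle_le k)).choose_spec
    obtain ⟨hl1, hl2⟩ := (c.exists_hom_basedPair (bitAngle_le l)).choose_spec
    obtain ⟨h1, h2⟩ := (c.exists_hom_basedPair (bitAngle_le (k ≫ l))).choose_spec
    refine (Arrow.mk_inj _ _).1 (c.arrowMk_eq_of_len_eq rfl rfl (fun i => ?_) fun i => ?_)
    · rw [len_comp_fst, h1, hk1, hl1, add_zero]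
    · rw [len_comp_snd, h2, hk2, hl2]
      change _ + ((k.1 i + l.1 i : ℕ) : ℝ) * _ - _ = _
      push_cast
      ring

lemma degree_sectionFunctor_map {d d' : BitVec01 n} (k : d ⟶ d') (i : Fin n) :
    c.degree (c.sectionFunctor.map k) i = k.1 i := by
  obtain ⟨h1, h2⟩ := (c.exists_hom_basedPair (bitAngle_le k)).choose_spec
  refine c.degree_eq ?_
  change c.len (c.exists_hom_basedPair (bitAngle_le k)).choose.1 i +
    c.arc (c.basedPair (bitAngle d)) i + c.len (c.exists_hom_basedPair (bitAngle_le k)).choose.2 i =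
      c.arc (c.basedPair (bitAngle d')) i + _
  have hd := bitAngle_mem_Ico d i
  have hd' := bitAngle_mem_Ico d' i
  rw [h1, h2, c.arc_basedPair hd.1 hd.2, c.arc_basedPair hd'.1 hd'.2]
  ring

lemma sectionFunctor_comp_degreeFunctor : c.sectionFunctor ⋙ c.degreeFunctor = 𝟭 _ :=
  Arrow.functor_ext fun d d' k => BitVec01.arrowMk_eq (c.bits_basedPair_bitAngle d)
    (c.bits_basedPair_bitAngle d') (c.degree_sectionFunctor_map k)

lemma degreeFunctor_comp_sectionFunctor_comp_pairComponent :
    c.degreeFunctor ⋙ c.sectionFunctor ⋙ pairComponent 𝓕 α D = pairComponent 𝓕 α D :=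
  Arrow.functor_ext fun _ _ e => (c.arrowMk_pairComponent_map_eq_iff 𝓕 α).2 <|
    arrowMk_map_eq_of_functor_eq c.sectionFunctor_comp_degreeFunctor (c.degreeFunctor.map e)

lemma componentDegree_comp_section :
    c.componentDegree 𝓕 α ⋙ c.sectionFunctor ⋙ pairComponent 𝓕 α D = 𝟭 _ := by
  apply pairComponent_functor_ext
  rw [← Functor.assoc, pairComponent_comp_componentDegree,
    degreeFunctor_comp_sectionFunctor_comp_pairComponent]
  rfl

lemma section_comp_componentDegree :
    (c.sectionFunctor ⋙ pairComponent 𝓕 α D) ⋙ c.componentDegree 𝓕 α = 𝟭 _ := by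
  rw [Functor.assoc, pairComponent_comp_componentDegree, sectionFunctor_comp_degreeFunctor]

end TorusChart

/-! ### The pair component categories of directed tori -/

lemma TorusChart.isIsoOfCategories_componentDegree {X : Type u} [TopologicalSpace X]
    {D : DStructure X} {n : ℕ} (c : TorusChart D n) (𝓕 : EquivalenceFamily.{u}) (α : Flavour) :
    IsIsoOfCategories (c.componentDegree 𝓕 α) :=
  ⟨c.sectionFunctor ⋙ pairComponent 𝓕 α D, c.componentDegree_comp_section 𝓕 α,
    c.section_comp_componentDegree 𝓕 α⟩

namespace IsIsoOfCategories

lemma comp {A : Type*} {B : Type*} {C : Type*} [Category* A] [Category* B] [Category* C]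
    {F : A ⥤ B} {G : B ⥤ C} (hF : IsIsoOfCategories F) (hG : IsIsoOfCategories G) :
    IsIsoOfCategories (F ⋙ G) := by
  obtain ⟨F', hFF', hF'F⟩ := hF
  obtain ⟨G', hGG', hG'G⟩ := hG
  refine ⟨G' ⋙ F', ?_, ?_⟩
  · rw [Functor.assoc, ← Functor.assoc G, hGG', Functor.id_comp, hFF']
  · rw [Functor.assoc, ← Functor.assoc F', hF'F, Functor.id_comp, hG'G]

lemma bijective_obj {A : Type*} {B : Type*} [Category* A] [Category* B] {F : A ⥤ B}
    (hF : IsIsoOfCategories F) : Function.Bijective F.obj := by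
  obtain ⟨G, hFG, hGF⟩ := hF
  exact Function.bijective_iff_has_inverse.2
    ⟨G.obj, fun a => Functor.congr_obj hFG a, fun b => Functor.congr_obj hGF b⟩

end IsIsoOfCategories

/-- The projection to the `i`-th entry, as a bit vector of length one. -/
def bitProj (n : ℕ) (i : Fin n) : BitVec01 n ⥤ BitVec01 1 where
  obj d := ⟨fun _ => d.bit i⟩
  map k := ⟨fun _ => k.1 i, fun _ => k.2 i⟩

/-- The functor assembling `n` bit vectors of length one, inverse to the tuple of projections. -/
def bitPi (n : ℕ) : (Fin n → BitVec01 1) ⥤ BitVec01 n where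
  obj d := ⟨fun i => (d i).bit 0⟩
  map k := ⟨fun i => (k i).1 0, fun i => (k i).2 0⟩

lemma bitPi_comp_bitProj (n : ℕ) (i : Fin n) :
    bitPi n ⋙ bitProj n i = Pi.eval (fun _ => BitVec01 1) i := by
  have hobj : ∀ d, (bitPi n ⋙ bitProj n i).obj d = d i := fun d =>
    BitVec01.ext_bit fun j => by rw [Subsingleton.elim j 0]; rfl
  refine Arrow.functor_ext fun d d' k => BitVec01.arrowMk_eq (hobj d) (hobj d') fun j => ?_
  rw [Subsingleton.elim j 0]
  rfl

lemma isIsoOfCategories_pi'_bitProj (n : ℕ) : IsIsoOfCategories (Functor.pi' (bitProj n)) :=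
  ⟨bitPi n, rfl, Functor.pi_ext _ _ (bitPi_comp_bitProj n)⟩

lemma natCard_bitVec01 (n : ℕ) : Nat.card (BitVec01 n) = 2 ^ n := by
  let e : BitVec01 n ≃ (Fin n → Bool) := ⟨BitVec01.bit, BitVec01.mk, fun _ => rfl, fun _ => rfl⟩
  rw [Nat.card_congr e, Nat.card_fun, Nat.card_eq_fintype_card, Nat.card_eq_fintype_card,
    Fintype.card_bool, Fintype.card_fin]

lemma isIsoOfCategories_pi {I : Type*} {A : I → Type*} {B : I → Type*} [∀ i, Category* (A i)]
    [∀ i, Category* (B i)] {F : ∀ i, A i ⥤ B i} (hF : ∀ i, IsIsoOfCategories (F i)) :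
    IsIsoOfCategories (Functor.pi F) := by
  choose G hFG hGF using hF
  refine ⟨Functor.pi G, Functor.pi_ext _ _ fun i => ?_, Functor.pi_ext _ _ fun i => ?_⟩
  · exact congrArg (Pi.eval A i ⋙ ·) (hFG i)
  · exact congrArg (Pi.eval B i ⋙ ·) (hGF i)

lemma len_map_torusProj {n : ℕ} (i : Fin n) {x y : Fin n → Circle} (σ : FundHom (dTorus n) x y) :
    circleChart.len (FundHom.map _ (isDMap_torusProj n i) rfl rfl σ) 0 =
      (torusChart n).len σ i := by
  rw [(torusChart n).len_map circleChart (isDMap_torusProj n i) rfl rfl (θ := fun _ => 0)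
    continuous_const (fun x => by rw [Circle.exp_zero, mul_one]; rfl) σ, add_zero, sub_zero]

lemma degreeFunctor_comp_bitProj (n : ℕ) (i : Fin n) :
    (torusChart n).degreeFunctor ⋙ bitProj n i =
      extMap (torusProj n i) (isDMap_torusProj n i) ⋙ circleChart.degreeFunctor := by
  have hobj : ∀ p, ((torusChart n).degreeFunctor ⋙ bitProj n i).obj p =
      (extMap (torusProj n i) (isDMap_torusProj n i) ⋙ circleChart.degreeFunctor).obj p :=
    fun p => BitVec01.ext_bit fun j => by rw [Subsingleton.elim j 0]; rfl
  refine Arrow.functor_ext fun p q e => BitVec01.arrowMk_eq (hobj p) (hobj q) fun j => ?_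
  rw [Subsingleton.elim j 0]
  refine (circleChart.degree_eq (Eq.trans ?_ ((torusChart n).extLen_eq e i))).symm
  rw [TorusChart.extLen, TorusChart.extLen, ← len_map_torusProj i e.1, ← len_map_torusProj i e.2]
  rfl

theorem mainTheorem2 (n : ℕ) (𝓕 : EquivalenceFamily.{0}) (α : Flavour) :
    (∃ Φ : PairComponentCategory 𝓕 α (dTorus n) ⥤ (Fin n → PairComponentCategory 𝓕 α dCircle),
      IsIsoOfCategories Φ ∧
      pairComponent 𝓕 α (dTorus n) ⋙ Φ =
        Functor.pi' fun i =>
          extMap (torusProj n i) (isDMap_torusProj n i) ⋙ pairComponent 𝓕 α dCircle) ∧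
    (∃ Ψ : PairComponentCategory 𝓕 α (dTorus n) ⥤ BitVec01 n,
      IsIsoOfCategories Ψ ∧
      ∀ (p : RPair (dTorus n)) (i : Fin n),
        (Ψ.obj ((pairComponent 𝓕 α (dTorus n)).obj p)).bit i = true ↔ p.src i ≠ p.tgt i) ∧
    Nat.card (PairComponentCategory 𝓕 α (dTorus n)) = 2 ^ n ∧
    (∀ (f : C(Fin n → Circle, Fin n → Circle)) (p q : RPair (dTorus n)),
      IsInessential 𝓕 (dTorus n) α f p q →
      ∃ g : Fin n → (Circle ≃ₜ Circle),
        (∀ i, IsDMap dCircle dCircle (g i : C(Circle, Circle)) ∧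
          IsDMap dCircle dCircle ((g i).symm : C(Circle, Circle))) ∧
        ∀ x i, f x i = g i (x i)) := by
  have hΨ := (torusChart n).isIsoOfCategories_componentDegree 𝓕 α
  have hS : IsIsoOfCategories (circleChart.sectionFunctor ⋙ pairComponent 𝓕 α dCircle) :=
    ⟨circleChart.componentDegree 𝓕 α, circleChart.section_comp_componentDegree 𝓕 α,
      circleChart.componentDegree_comp_section 𝓕 α⟩
  refine ⟨⟨(torusChart n).componentDegree 𝓕 α ⋙ Functor.pi' (bitProj n) ⋙ Functor.pi fun _ =>
      circleChart.sectionFunctor ⋙ pairComponent 𝓕 α dCircle,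
      hΨ.comp ((isIsoOfCategories_pi'_bitProj n).comp (isIsoOfCategories_pi fun _ => hS)), ?_⟩,
    ⟨_, hΨ, fun _ _ => (torusChart n).bits_eq_true_iff⟩,
    (Nat.card_congr (Equiv.ofBijective _ hΨ.bijective_obj)).trans (natCard_bitVec01 n),
    fun f p q hf => ?_⟩
  · rw [← Functor.assoc, TorusChart.pairComponent_comp_componentDegree]
    refine Functor.pi_ext _ _ fun i => ?_
    change ((torusChart n).degreeFunctor ⋙ bitProj n i) ⋙ circleChart.sectionFunctor ⋙
      pairComponent 𝓕 α dCircle = _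
    rw [degreeFunctor_comp_bitProj, Functor.assoc,
      TorusChart.degreeFunctor_comp_sectionFunctor_comp_pairComponent]
    rfl
  · obtain ⟨δ, rfl⟩ := (torusChart n).exists_eq_shiftMap_of_isInessential hf
    exact ⟨fun i => (δ i).toHomeomorph,
      fun i => ⟨(δ i).isDMap_toHomeomorph, (δ i).isDMap_toHomeomorph_symm⟩, fun x i => rfl⟩
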